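/- **Theorem (Soundness of the relational refinement type system of PrivInfer).** If $\mathcal G\vdash e_1\sim e_2::T$ is derivable, then for every valuation $\theta\models\mathcal G$ we have $(\llbracket e_1\rrbracket_\theta,\llbracket e_2\rrbracket_\theta)\in(\!|T|\!)_\theta$. Here the language, its semantics and the judgment are as follows. *Divergences and liftings.* A distribution over a set $A$ is a function $\mu:A\to[0,1]$ with countable support and $\sum_a\mu(a)=1$. $\mathcal F$ is the set of functions $f$ to $\mathbb R$ that are convex on $(0,\infty)$ with $f(1)=0$. $\Delta_f(\mu_1\mid\mu_2)=\sum_a\mu_2(a)f(\mu_1(a)/\mu_2(a))\in(-\infty,\infty]$ with $0f(0/0)=0$, $0f(a/0)=a\lim_{u\to\infty}f(u)/u$, $f(0)=\lim_{t\downarrow0}f(t)$. $(f_1,f_2)$ are $f_3$-composable if $f_1,f_2,f_3\in\mathcal F$ and $\Delta_{f_3}(\mathrm{bind}\,\mu_1M_1\mid\mathrm{bind}\,\mu_2M_2)\le\Delta_{f_1}(\mu_1\mid\mu_2)+\sup_v\Delta_{f_2}(M_1v\mid M_2v)$ for all sets $A,B$, distributions $\mu_1,\mu_2$ over $A$ and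 maps $M_1,M_2$ from $A$ to distributions over $B$. For a relation $\Psi\subseteq A\times B$, the pair $(\mu_1,\mu_2)$ is in the $(f,\delta)$-lifting of $\Psi$ if there are distributions $\mu_L,\mu_R$ over $A\times B$ with supports in $\Psi$, $\pi_1\mu_L=\mu_1$, $\pi_2\mu_R=\mu_2$ and $\Delta_f(\mu_L\mid\mu_R)\le\delta$. *Simple types.* $\tilde\tau::=\bullet\mid\mathbb B\mid\mathbb N\mid\mathbb R\mid\mathbb R^+\mid\overline{\mathbb R}^+\mid[0,1]\mid\mathrm{List}\,\tilde\tau$ (with $\mathbb R^+=[0,\infty)$, $\overline{\mathbb R}^+=[0,\infty]$), $\kappa::=\tilde\tau\mid\mathfrak D[\tilde\tau]$ and $\tau::=\kappa\mid\mathfrak M[\kappa]\mid\tau\to\sigma$. Basic types and arrows are interpreted by the corresponding sets and full function spaces, $\mathfrak M[\kappa]$ by the distributions over $\llbracket\kappa\rrbracket$, and $\mathfrak D[\tilde\tau]$ by symbolic distributions: $\mathsf{bernoulli}(p)$ over $\mathbb B$; $\mathsf{uniform}$, $\mathsf{beta}(a,b)$ over $[0,1]$; $\mathsf{normal}(m,v)$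 over $\mathbb R$ ($v$ the variance); and, over every $\tilde\tau\ne\mathbb B$, an explicit table of any distribution. *Expressions* are the simply typed terms built from variables, constants (any element of $\llbracket\tau\rrbracket$), application, $\lambda$, $\mathsf{letrec}\,f\,x=e$, case analysis on $\bullet$, $\mathbb B$, $\mathbb N$ and lists, $\mathsf{unitM}\,e$, $\mathsf{bindM}\,x=e_1\,\mathsf{in}\,e_2$, $\mathsf{observe}\,x\Rightarrow t\,\mathsf{in}\,u$, $\mathsf{infer}\,e$, $\mathsf{ran}\,e$, $\mathsf{bernoulli}$, $\mathsf{uniform}$, $\mathsf{beta}$, $\mathsf{normal}$, $\mathsf{lapMech}(\varepsilon,x)$, $\mathsf{gaussMech}(\sigma,x)$ and $\mathsf{expMech}(\varepsilon,q,d)$. The denotation is standard: $\mathsf{unitM}$ is the Dirac distribution; $\mathsf{bindM}$ is monadic composition; $\mathsf{observe}$ gives $d\mapsto\llbracket u\rrbracket(d)\,\llbracket t\rrbracket_{x\mapsto d}(\mathsf{true})$, rescaled to total mass $1$; $\mathsf{ran}$ maps a symbolic distribution to the distribution it denotes; $\mathsf{infer}\,e=\mathsf{AlgInf}\,\llbracket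 e\rrbracket$, where $\mathsf{AlgInf}$ is an arbitrary total and exact inference algorithm, i.e. $\mathsf{ran}(\mathsf{AlgInf}\,\mu)=\mu$ for every $\mu$. $\mathsf{lapMech}$ and $\mathsf{gaussMech}$ are the Laplace distribution with mean $x$ and scale $1/\varepsilon$ and the Gaussian distribution with mean $x$ and standard deviation $\sigma$. Continuous distributions are rounded down to the grid $\frac1N\mathbb Z$, for an arbitrary fixed precision $N\geq1$. $\mathsf{expMech}$ weights the output $r$ by $\exp(q(d,r)\varepsilon/2)$ and normalizes, over an arbitrary fixed finite set of outputs if the sum over all $r$ diverges. $\mathsf{letrec}$ denotes the unique solution of its recursive equation $g=\Phi g$ if the recursion is *terminating*: for some well-founded order on the arguments, $\Phi g\,x$ depends only on the values of $g$ below $x$. In the remaining ill-defined cases a fixed default is taken: the prior if the observation has probability $0$; an arbitrary fixed function for a non-terminating $\mathsf{letrec}$; a point mass for degenerate parameters. *Relational types and assertions.* Each relational variable $x$ has a left and a right instance $x_\triangleleft,x_\triangleright$. Types are $T,U::=\tilde\tau\mid\mathfrak D[\tilde\tau]\mid\mathfrak M_{f,\delta}[T]\mid\Pi(x::T).U\mid\{x::T\mid\phi\}$,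 where in $\mathfrak M_{f,\delta}[T]$ the erasure $|T|$ is some $\kappa$. Assertions are built from $\Delta_f(e,e')\le\delta$ (for symbolic or for actual distributions; symbolic ones are compared through $\mathsf{ran}$), $f\in\mathcal F$, $e=e'$, $e\le e'$, propositional connectives, and quantifiers over simple and over relational types. Here $f:\mathbb R^+\to\mathbb R$, $\delta:\overline{\mathbb R}^+$, $e,e'$ are expressions over plain variables and instances of relational variables. Assertions are interpreted as written, and: $(\!|\tilde\tau|\!)$ and $(\!|\mathfrak D[\tilde\tau]|\!)$ relate all pairs; $(\!|\{x::T\mid\phi\}|\!)_\theta$ is the set of $(d_1,d_2)\in(\!|T|\!)_\theta$ such that $\phi$ holds under $\theta[x_\triangleleft\mapsto d_1,x_\triangleright\mapsto d_2]$; $(h_1,h_2)\in(\!|\Pi(x::T).U|\!)_\theta$ iff $(h_1d_1,h_2d_2)\in(\!|U|\!)_{\theta[x_\triangleleft\mapsto d_1,x_\triangleright\mapsto d_2]}$ for all $(d_1,d_2)\in(\!|T|\!)_\theta$; $(\!|\mathfrak M_{f,\delta}[T]|\!)_\theta$ is the $(\llbracket f\rrbracket_\theta,\llbracket\delta\rrbracket_\theta)$-lifting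 of $(\!|T|\!)_\theta$. An environment $\mathcal G$ is a sequence of bindings $x::T$ and assumptions $\{\phi\}$; $\theta\models\mathcal G$ means that $\theta$ gives all instances values of the right simple types, $(\theta x_\triangleleft,\theta x_\triangleright)\in(\!|T|\!)_\theta$ for each binding, and every assumption holds. In a judgment, $\llbracket e_1\rrbracket_\theta$ reads each variable of $e_1$ as its left instance, and $\llbracket e_2\rrbracket_\theta$ each variable of $e_2$ as its right instance; $e_\triangleleft,e'_\triangleright$ below are $e$ and $e'$ with variables so replaced. $\{=\}_\kappa$ abbreviates $\{y::\kappa\mid y_\triangleleft=y_\triangleright\}$, and "valid" means true for all $\theta\models\mathcal G$. *Subtyping* $\mathcal G\vdash T\preceq U$ is generated by reflexivity; transitivity; $\{x::T\mid\phi\}\preceq T$; $T\preceq\{x::U\mid\phi\}$ if $T\preceq U$ and $\phi$ is true for all $\theta\models\mathcal G,x::T$; $\Pi(x::T_1).U_1\preceq\Pi(x::T_2).U_2$ if $T_2\preceq T_1$ and $\mathcal G,x::T_2\vdash U_1\preceq U_2$; and monadic subtyping: $\mathfrak M_{f_1,\delta_1}[T]\preceq\mathfrak M_{f_2,\delta_2}[U]$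 if $T\preceq U$, $f_1,f_2\in\mathcal F$ are valid, and for all $\theta\models\mathcal G,x::T$ one has $f_2\le f_1$ pointwise on $(0,\infty)$ and $\delta_1\le\delta_2<\infty$. *Typing* $\mathcal G\vdash e\sim e'::T$ is generated by the following rules (simple typing of all expressions is understood). 1. Variables: $x\sim x::T$ if $x::T$ is in $\mathcal G$. Constants: $c\sim c::T$ for closed $T$ with $(c,c)\in(\!|T|\!)$. 2. Abstraction: $\lambda x.e\sim\lambda x.e'::\Pi(x::T).U$ if $\mathcal G,x::T\vdash e\sim e'::U$. Application: $e\,a\sim e'\,a'::U\{x_\triangleleft\mapsto a_\triangleleft,x_\triangleright\mapsto a'_\triangleright\}$ if $e\sim e'::\Pi(x::T).U$ and $a\sim a'::T$. 3. Recursion: $\mathsf{letrec}\,f\,x=e\sim\mathsf{letrec}\,f\,x=e'::\Pi(x::T).U$ if under every $\theta\models\mathcal G$ both recursions are terminating and $\mathcal G,x::T,f::\Pi(y::\{y::T\mid m(y)+1\le m(x)\}).U\{x\mapsto y\}\vdash e\sim e'::U$, for some measure $m$, a relational expression of type $\mathbb N$ in $x_\triangleleft,x_\triangleright$ and the variables of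 $\mathcal G$. 4. Case analysis: if the scrutinees $e\sim e'$ have some relational type and $e_\triangleleft,e'_\triangleright$ have the same head constructor under every $\theta\models\mathcal G$, the branches are typed pairwise under the assumption that $e_\triangleleft$ and $e'_\triangleright$ are equal to the pattern (bound variables having their basic types); for $\bullet$ there is one branch and no assumption. For $\mathbb B$, $\mathbb N$ and lists there are also one-sided versions, with case analysis in the left or in the right run only and the corresponding assumption on that side. 5. Subsumption along $\preceq$; self-refinement: $e\sim e'::\{x::T\mid x_\triangleleft=e_\triangleleft\wedge x_\triangleright=e'_\triangleright\}$ if $e\sim e'::T$; conversion: $e$ and $e'$ may be replaced by expressions with the same denotation under all $\theta\models\mathcal G$ (in particular by reduction). 6. UnitM: $\mathsf{unitM}\,e\sim\mathsf{unitM}\,e'::\mathfrak M_{f,\delta}[T]$ if $e\sim e'::T$ and $f\in\mathcal F$ is valid. 7. BindM: $\mathsf{bindM}\,x=e_1\,\mathsf{in}\,e_2\sim\mathsf{bindM}\,x=e_1'\,\mathsf{in}\,e_2'::\mathfrak M_{f_3,\delta_1+\delta_2}[T_2]$ if $e_1\sim e_1'::\mathfrak M_{f_1,\delta_1}[T_1]$,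 if $(f_1,f_2)$ are $f_3$-composable under all $\theta\models\mathcal G$, and if $\mathcal G,x::T_1\vdash e_2\sim e_2'::\mathfrak M_{f_2,\delta_2}[T_2]$, where $f_2,\delta_2,T_2$ do not mention $x$. 8. Infer: $\mathsf{infer}\,e\sim\mathsf{infer}\,e'::\{x::\mathfrak D[\tilde\tau]\mid\Delta_f(x_\triangleleft,x_\triangleright)\le\delta\}$ if $e\sim e'::\mathfrak M_{f,\delta}[\{=\}_{\tilde\tau}]$. 9. Ran: $\mathsf{ran}\,e\sim\mathsf{ran}\,e'::\mathfrak M_{f,\delta}[\{=\}_{\tilde\tau}]$ if $e\sim e'::\{x::\mathfrak D[\tilde\tau]\mid\Delta_f(x_\triangleleft,x_\triangleright)\le\delta\}$. 10. Observe: with $o=\mathsf{observe}\,x\Rightarrow t\,\mathsf{in}\,u$ and $o'=\mathsf{observe}\,x\Rightarrow t'\,\mathsf{in}\,u'$, $o\sim o'::\mathfrak M_{f,\delta''}[\{=\}_{\tilde\tau}]$ if $u\sim u'::\mathfrak M_{f,\delta}[\{=\}_{\tilde\tau}]$, $\mathcal G,x::\tilde\tau\vdash t\sim t'::\mathfrak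 M_{f,\delta'}[\{=\}_{\mathbb B}]$, and $\Delta_f(o_\triangleleft,o'_\triangleright)\le\delta''$ is valid. 11. Primitives: $\mathsf{bernoulli},\mathsf{uniform},\mathsf{beta},\mathsf{normal}$ applied to relationally typed arguments have the type $\mathfrak D[\cdot]$. If $c$ is $\mathsf{lapMech}$, $\mathsf{gaussMech}$ or $\mathsf{expMech}$, $\vec a\sim\vec a'$ are relationally typed, and $\Delta_f(c(\vec a)_\triangleleft,c(\vec a')_\triangleright)\le\delta$ is valid, then $c(\vec a)\sim c(\vec a')::\mathfrak M_{f,\delta}[\{=\}_\kappa]$, where $\kappa$ is the type of the outputs of $c$. -/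

import Mathlib

open scoped NNReal ENNReal Topology

noncomputable section

namespace PrivInfer

/-! ## f-divergences, composability and liftings -/

/-- The class of convex functions `f`, defined for `x > 0`, with `f 1 = 0`.
The value `f 0` plays no role. -/
def FClass (f : ℝ≥0 → ℝ) : Prop :=
  ConvexOn ℝ (Set.Ioi (0 : ℝ)) (fun x => f x.toNNReal) ∧ f 1 = 0

/-- The limit of `f` at `0` from the right. For convex `f` the limit exists in `(-∞, ∞]`
and is equal to this `limsup`. -/
def fZero (f : ℝ≥0 → ℝ) : EReal :=
  Filter.limsup (fun t : ℝ≥0 => ((f t : ℝ) : EReal)) (𝓝[>] 0)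

/-- The limit of `f u / u` as `u → ∞`. For convex `f` the limit exists in `(-∞, ∞]`
and is equal to this `limsup`. -/
def fSlope (f : ℝ≥0 → ℝ) : EReal :=
  Filter.limsup (fun u : ℝ≥0 => ((f u / (u : ℝ) : ℝ) : EReal)) Filter.atTop

open Classical in
/-- The summand `b * f (a / b)`, with the conventions `0 * f (0 / 0) = 0`,
`0 * f (a / 0) = a * lim f u / u` and `f 0 = lim f t` for `t ↓ 0`. -/
def divTerm (f : ℝ≥0 → ℝ) (a b : ℝ≥0) : EReal :=
  if b = 0 then (if a = 0 then 0 else ((a : ℝ) : EReal) * fSlope f)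
  else if a = 0 then ((b : ℝ) : EReal) * fZero f
  else (((b : ℝ) * f (a / b) : ℝ) : EReal)

/-- The f-divergence of `μ₁` from `μ₂`: the sum of the positive parts of the summands minus
the sum of their negative parts. The latter is finite whenever `FClass f`. -/
def fDiv {α : Type} (f : ℝ≥0 → ℝ) (μ₁ μ₂ : PMF α) : EReal :=
  ((∑' a, (divTerm f (μ₁ a).toNNReal (μ₂ a).toNNReal).toENNReal : ℝ≥0∞) : EReal)
    - ((∑' a, (-divTerm f (μ₁ a).toNNReal (μ₂ a).toNNReal).toENNReal : ℝ≥0∞) : EReal)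

/-- `μ₁` and `μ₂` are `(f, δ)`-close. -/
def AreClose {α : Type} (f : ℝ≥0 → ℝ) (δ : ℝ≥0∞) (μ₁ μ₂ : PMF α) : Prop :=
  fDiv f μ₁ μ₂ ≤ (δ : EReal)

/-- The indices `(f₁, δ₁)` are at least as strong as `(f₂, δ₂)`: `f₂ ≤ f₁` on the positive reals
(hence the `f₂`-divergence is at most the `f₁`-divergence) and `δ₁ ≤ δ₂ < ∞`. -/
def IndexLe (f₁ : ℝ≥0 → ℝ) (δ₁ : ℝ≥0∞) (f₂ : ℝ≥0 → ℝ) (δ₂ : ℝ≥0∞) : Prop :=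
  (∀ x : ℝ≥0, 0 < x → f₂ x ≤ f₁ x) ∧ δ₁ ≤ δ₂ ∧ δ₂ < ∞

/-- `(f₁, f₂)` are `f₃`-composable. -/
def Composable (f₁ f₂ f₃ : ℝ≥0 → ℝ) : Prop :=
  FClass f₁ ∧ FClass f₂ ∧ FClass f₃ ∧
    ∀ (A B : Type) (μ₁ μ₂ : PMF A) (M₁ M₂ : A → PMF B),
      fDiv f₃ (μ₁.bind M₁) (μ₂.bind M₂) ≤ fDiv f₁ μ₁ μ₂ + ⨆ v, fDiv f₂ (M₁ v) (M₂ v)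

/-- The `(f, δ)`-lifting of a relation `Ψ`, with a left and a right witness. -/
def Lifting {α β : Type} (f : ℝ≥0 → ℝ) (δ : ℝ≥0∞) (Ψ : α → β → Prop)
    (μ₁ : PMF α) (μ₂ : PMF β) : Prop :=
  ∃ μL μR : PMF (α × β),
    (∀ p ∈ μL.support, Ψ p.1 p.2) ∧ (∀ p ∈ μR.support, Ψ p.1 p.2) ∧
    μL.map Prod.fst = μ₁ ∧ μR.map Prod.snd = μ₂ ∧ AreClose f δ μL μR

/-! ## Discrete distributions -/

open Classical in
/-- The distribution proportional to `w`, or `μ` if the total weight is `0` or `∞`. -/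
def normalizeOr {α : Type} (w : α → ℝ≥0∞) (μ : PMF α) : PMF α :=
  if h : tsum w ≠ 0 ∧ tsum w ≠ ∞ then PMF.normalize w h.1 h.2 else μ

/-- The discrete version, on the grid of mesh `1 / N`, of a distribution on the line: the mass
of the cell `[k / N, (k + 1) / N)` is moved to the point `k / N`. (A measure whose total mass is
`0` or `∞` is replaced by the point mass at `0`; this occurs only for degenerate parameters.) -/
def discretize (N : ℕ+) (μ : MeasureTheory.Measure ℝ) : PMF ℝ :=
  (normalizeOr (fun k : ℤ => μ (Set.Ico ((k : ℝ) / N) (((k : ℝ) + 1) / N))) (PMF.pure 0)).map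
    (fun k => (k : ℝ) / N)

/-- The Laplace distribution with mean `x` and scale `1 / ε`. -/
def laplaceMeasure (ε : ℝ≥0) (x : ℝ) : MeasureTheory.Measure ℝ :=
  MeasureTheory.volume.withDensity
    (fun y => ENNReal.ofReal ((ε : ℝ) / 2 * Real.exp (-(|y - x| * ε))))

/-- The Bernoulli distribution. -/
def bernoulliPMF (p : unitInterval) : PMF Bool :=
  PMF.ofFintype (fun d => ENNReal.ofReal (if d then (p : ℝ) else 1 - p)) (by
    rw [Fintype.sum_bool]
    simp only [if_true, Bool.false_eq_true, if_false]
    rw [← ENNReal.ofReal_add p.2.1 (by linarith [p.2.2])]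
    simp)

/-! ## Simple types and their interpretation -/

/-- Basic types; `nnreal` and `ennreal` are the types of (nonnegative) positive reals without and
with infinity, and `unitI` is the unit interval. -/
inductive BTy : Type
  | unit | bool | nat | real | nnreal | ennreal | unitI
  | list (b : BTy)

/-- Interpretation of basic types. -/
@[reducible] def BTy.interp : BTy → Type
  | .unit => Unit
  | .bool => Bool
  | .nat => ℕ
  | .real => ℝ
  | .nnreal => ℝ≥0
  | .ennreal => ℝ≥0∞
  | .unitI => unitInterval
  | .list b => List b.interp

/-- Symbolic distributions over a basic type: syntactic representations parametrized by values.
Over the booleans these are exactly the expressions `bernoulli v`. Over the other basic types there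
is, besides the named families, an explicit table of the values and their weights, so that every
distribution has a symbolic representation. -/
inductive SymDist : BTy → Type
  | bernoulli (p : unitInterval) : SymDist .bool
  | uniform : SymDist .unitI
  | beta (a b : ℝ≥0) : SymDist .unitI
  | normal (m : ℝ) (v : ℝ≥0) : SymDist .real
  | table {b : BTy} (hb : b ≠ .bool) (μ : PMF b.interp) : SymDist b

/-- Conversion of a symbolic distribution to the actual (discrete) distribution that it denotes;
the continuous families are taken in their discrete versions of precision `1 / N`. -/
def SymDist.ran (N : ℕ+) : {b : BTy} → SymDist b → PMF b.interp
  | _, .bernoulli p => bernoulliPMF p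
  | _, .uniform =>
      (discretize N (MeasureTheory.volume.restrict (Set.Icc 0 1))).map
        (Set.projIcc (0 : ℝ) 1 zero_le_one)
  | _, .beta a b =>
      (discretize N (ProbabilityTheory.betaMeasure a b)).map (Set.projIcc (0 : ℝ) 1 zero_le_one)
  | _, .normal m v => discretize N (ProbabilityTheory.gaussianReal m v)
  | _, .table _ μ => μ

/-- The types over which the probability monad may be applied: basic types and symbolic
distributions over basic types. -/
inductive VTy : Type
  | base (b : BTy)
  | dist (b : BTy)

@[reducible] def VTy.interp : VTy → Type
  | .base b => b.interp
  | .dist b => SymDist b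

/-- Simple types: `val k` is a basic type or a type of symbolic distributions, `mon k` is the type
of actual distributions over `k`. -/
inductive Ty : Type
  | val (k : VTy)
  | mon (k : VTy)
  | arr (τ σ : Ty)

/-- Interpretation of simple types. -/
@[reducible] def Ty.interp : Ty → Type
  | .val k => k.interp
  | .mon k => PMF k.interp
  | .arr τ σ => τ.interp → σ.interp

instance BTy.interp.instNonempty : (b : BTy) → Nonempty b.interp
  | .unit => ⟨()⟩
  | .bool => ⟨true⟩
  | .nat => ⟨(0 : ℕ)⟩
  | .real => ⟨(0 : ℝ)⟩
  | .nnreal => ⟨(0 : ℝ≥0)⟩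
  | .ennreal => ⟨(0 : ℝ≥0∞)⟩
  | .unitI => ⟨(0 : unitInterval)⟩
  | .list _ => ⟨[]⟩

instance VTy.interp.instNonempty : (k : VTy) → Nonempty k.interp
  | .base b => BTy.interp.instNonempty b
  | .dist .bool => ⟨SymDist.bernoulli 0⟩
  | .dist .unit => ⟨.table (by simp) (PMF.pure (BTy.interp.instNonempty _).some)⟩
  | .dist .nat => ⟨.table (by simp) (PMF.pure (BTy.interp.instNonempty _).some)⟩
  | .dist .real => ⟨.table (by simp) (PMF.pure (BTy.interp.instNonempty _).some)⟩
  | .dist .nnreal => ⟨.table (by simp) (PMF.pure (BTy.interp.instNonempty _).some)⟩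
  | .dist .ennreal => ⟨.table (by simp) (PMF.pure (BTy.interp.instNonempty _).some)⟩
  | .dist .unitI => ⟨.table (by simp) (PMF.pure (BTy.interp.instNonempty _).some)⟩
  | .dist (.list _) => ⟨.table (by simp) (PMF.pure (BTy.interp.instNonempty _).some)⟩

instance Ty.interp.instNonempty : (τ : Ty) → Nonempty τ.interp
  | .val k => VTy.interp.instNonempty k
  | .mon k => ⟨PMF.pure (VTy.interp.instNonempty k).some⟩
  | .arr _ σ => ⟨fun _ => (Ty.interp.instNonempty σ).some⟩

namespace Ty

abbrev unit : Ty := .val (.base .unit)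
abbrev bool : Ty := .val (.base .bool)
abbrev nat : Ty := .val (.base .nat)
abbrev real : Ty := .val (.base .real)
abbrev nnreal : Ty := .val (.base .nnreal)
abbrev ennreal : Ty := .val (.base .ennreal)
abbrev unitI : Ty := .val (.base .unitI)
abbrev list (b : BTy) : Ty := .val (.base (.list b))

/-- The type of the functions that index f-divergences. -/
abbrev fn : Ty := .arr .nnreal .real

end Ty

/-- The order on basic types that interprets the assertion `e ≤ e`. -/
def BTy.le : (b : BTy) → b.interp → b.interp → Prop
  | .unit => fun _ _ => True
  | .bool => fun (x y : Bool) => x ≤ y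
  | .nat => fun (x y : ℕ) => x ≤ y
  | .real => fun (x y : ℝ) => x ≤ y
  | .nnreal => fun (x y : ℝ≥0) => x ≤ y
  | .ennreal => fun (x y : ℝ≥0∞) => x ≤ y
  | .unitI => fun (x y : unitInterval) => x ≤ y
  | .list b => fun (x y : List b.interp) => List.Forall₂ b.le x y

/-- The order on simple types: that of the basic types, pointwise on functions, and discrete on
actual and symbolic distributions. -/
def Ty.le : (τ : Ty) → τ.interp → τ.interp → Prop
  | .val (.base b) => b.le
  | .val (.dist _) => fun x y => x = y
  | .mon _ => fun x y => x = y
  | .arr _ σ => fun x y => ∀ d, σ.le (x d) (y d)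

/-! ## Expressions

Expressions are well typed by construction. Variables are de Bruijn indices, the head of a context
being the variable that was bound last. -/

inductive Var : List Ty → Ty → Type
  | zero {Γ : List Ty} {τ : Ty} : Var (τ :: Γ) τ
  | succ {Γ : List Ty} {τ σ : Ty} (x : Var Γ τ) : Var (σ :: Γ) τ

/-- `Tm Γ τ` is the set of expressions `e` with `Γ ⊢ e : τ`. Every element of the interpretation
of a type may be used as a constant; in particular the constructors of data types, arithmetic
and the operation that extracts the parameters of a symbolic distribution are constants. -/
inductive Tm : List Ty → Ty → Type
  | var {Γ τ} (x : Var Γ τ) : Tm Γ τ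
  | const {Γ} {τ : Ty} (c : τ.interp) : Tm Γ τ
  | app {Γ τ σ} (e₁ : Tm Γ (.arr τ σ)) (e₂ : Tm Γ τ) : Tm Γ σ
  | lam {Γ τ σ} (e : Tm (τ :: Γ) σ) : Tm Γ (.arr τ σ)
  /-- `letrec f x = e`; in `e`, index `0` is `f` and index `1` is `x`. -/
  | letrec {Γ τ σ} (e : Tm (.arr τ σ :: τ :: Γ) σ) : Tm Γ (.arr τ σ)
  | caseUnit {Γ σ} (e : Tm Γ .unit) (e₁ : Tm Γ σ) : Tm Γ σ
  /-- `case e with [true ⇒ e₁ | false ⇒ e₂]` -/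
  | caseBool {Γ σ} (e : Tm Γ .bool) (e₁ e₂ : Tm Γ σ) : Tm Γ σ
  /-- `case e with [0 ⇒ e₁ | succ x ⇒ e₂]` -/
  | caseNat {Γ σ} (e : Tm Γ .nat) (e₁ : Tm Γ σ) (e₂ : Tm (.nat :: Γ) σ) : Tm Γ σ
  /-- `case e with [nil ⇒ e₁ | x :: l ⇒ e₂]`; in `e₂`, index `0` is `l` and index `1` is `x`. -/
  | caseList {Γ b σ} (e : Tm Γ (.list b)) (e₁ : Tm Γ σ)
      (e₂ : Tm (.list b :: .val (.base b) :: Γ) σ) : Tm Γ σ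
  | unitM {Γ k} (e : Tm Γ (.val k)) : Tm Γ (.mon k)
  /-- `bindM x = e₁ in e₂` -/
  | bindM {Γ k l} (e₁ : Tm Γ (.mon k)) (e₂ : Tm (.val k :: Γ) (.mon l)) : Tm Γ (.mon l)
  /-- `observe x ⇒ t in u` -/
  | observe {Γ b} (t : Tm (.val (.base b) :: Γ) (.mon (.base .bool)))
      (u : Tm Γ (.mon (.base b))) : Tm Γ (.mon (.base b))
  | infer {Γ b} (e : Tm Γ (.mon (.base b))) : Tm Γ (.val (.dist b))
  | ran {Γ b} (e : Tm Γ (.val (.dist b))) : Tm Γ (.mon (.base b))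
  | bernoulli {Γ} (e : Tm Γ .unitI) : Tm Γ (.val (.dist .bool))
  | uniform {Γ} : Tm Γ (.val (.dist .unitI))
  | beta {Γ} (e₁ e₂ : Tm Γ .nnreal) : Tm Γ (.val (.dist .unitI))
  | normal {Γ} (e₁ : Tm Γ .real) (e₂ : Tm Γ .nnreal) : Tm Γ (.val (.dist .real))
  | lapMech {Γ} (e₁ : Tm Γ .nnreal) (e₂ : Tm Γ .real) : Tm Γ (.mon (.base .real))
  | gaussMech {Γ} (e₁ : Tm Γ .nnreal) (e₂ : Tm Γ .real) : Tm Γ (.mon (.base .real))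
  | expMech {Γ τ k} (e₁ : Tm Γ .real) (e₂ : Tm Γ (.arr τ (.arr (.val k) .real)))
      (e₃ : Tm Γ τ) : Tm Γ (.mon k)

/-! ### Renaming and substitution -/

abbrev Ren (Γ Δ : List Ty) : Type := ∀ ⦃τ : Ty⦄, Var Γ τ → Var Δ τ

def Ren.lift {Γ Δ : List Ty} {σ : Ty} (ρ : Ren Γ Δ) : Ren (σ :: Γ) (σ :: Δ)
  | _, .zero => .zero
  | _, .succ x => .succ (ρ x)

def Tm.rename : {Γ Δ : List Ty} → {τ : Ty} → Ren Γ Δ → Tm Γ τ → Tm Δ τ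
  | _, _, _, ρ, .var x => .var (ρ x)
  | _, _, _, _, .const c => .const c
  | _, _, _, ρ, .app e₁ e₂ => .app (e₁.rename ρ) (e₂.rename ρ)
  | _, _, _, ρ, .lam e => .lam (e.rename ρ.lift)
  | _, _, _, ρ, .letrec e => .letrec (e.rename ρ.lift.lift)
  | _, _, _, ρ, .caseUnit e e₁ => .caseUnit (e.rename ρ) (e₁.rename ρ)
  | _, _, _, ρ, .caseBool e e₁ e₂ => .caseBool (e.rename ρ) (e₁.rename ρ) (e₂.rename ρ)
  | _, _, _, ρ, .caseNat e e₁ e₂ => .caseNat (e.rename ρ) (e₁.rename ρ) (e₂.rename ρ.lift)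
  | _, _, _, ρ, .caseList e e₁ e₂ =>
      .caseList (e.rename ρ) (e₁.rename ρ) (e₂.rename ρ.lift.lift)
  | _, _, _, ρ, .unitM e => .unitM (e.rename ρ)
  | _, _, _, ρ, .bindM e₁ e₂ => .bindM (e₁.rename ρ) (e₂.rename ρ.lift)
  | _, _, _, ρ, .observe t u => .observe (t.rename ρ.lift) (u.rename ρ)
  | _, _, _, ρ, .infer e => .infer (e.rename ρ)
  | _, _, _, ρ, .ran e => .ran (e.rename ρ)
  | _, _, _, ρ, .bernoulli e => .bernoulli (e.rename ρ)
  | _, _, _, _, .uniform => .uniform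
  | _, _, _, ρ, .beta e₁ e₂ => .beta (e₁.rename ρ) (e₂.rename ρ)
  | _, _, _, ρ, .normal e₁ e₂ => .normal (e₁.rename ρ) (e₂.rename ρ)
  | _, _, _, ρ, .lapMech e₁ e₂ => .lapMech (e₁.rename ρ) (e₂.rename ρ)
  | _, _, _, ρ, .gaussMech e₁ e₂ => .gaussMech (e₁.rename ρ) (e₂.rename ρ)
  | _, _, _, ρ, .expMech e₁ e₂ e₃ => .expMech (e₁.rename ρ) (e₂.rename ρ) (e₃.rename ρ)

/-- Weakening by one variable. -/
def Tm.wk {Γ : List Ty} {τ σ : Ty} (e : Tm Γ τ) : Tm (σ :: Γ) τ :=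
  e.rename fun _ x => .succ x

/-- Weakening by the two instances of a relational variable. -/
def Tm.wk2 {Γ : List Ty} {τ σ σ' : Ty} (e : Tm Γ τ) : Tm (σ :: σ' :: Γ) τ :=
  e.rename fun _ x => .succ (.succ x)

abbrev Subst (Γ Δ : List Ty) : Type := ∀ ⦃τ : Ty⦄, Var Γ τ → Tm Δ τ

def Subst.lift {Γ Δ : List Ty} {σ : Ty} (s : Subst Γ Δ) : Subst (σ :: Γ) (σ :: Δ)
  | _, .zero => .var .zero
  | _, .succ x => (s x).wk

def Tm.subst : {Γ Δ : List Ty} → {τ : Ty} → Subst Γ Δ → Tm Γ τ → Tm Δ τ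
  | _, _, _, s, .var x => s x
  | _, _, _, _, .const c => .const c
  | _, _, _, s, .app e₁ e₂ => .app (e₁.subst s) (e₂.subst s)
  | _, _, _, s, .lam e => .lam (e.subst s.lift)
  | _, _, _, s, .letrec e => .letrec (e.subst s.lift.lift)
  | _, _, _, s, .caseUnit e e₁ => .caseUnit (e.subst s) (e₁.subst s)
  | _, _, _, s, .caseBool e e₁ e₂ => .caseBool (e.subst s) (e₁.subst s) (e₂.subst s)
  | _, _, _, s, .caseNat e e₁ e₂ => .caseNat (e.subst s) (e₁.subst s) (e₂.subst s.lift)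
  | _, _, _, s, .caseList e e₁ e₂ =>
      .caseList (e.subst s) (e₁.subst s) (e₂.subst s.lift.lift)
  | _, _, _, s, .unitM e => .unitM (e.subst s)
  | _, _, _, s, .bindM e₁ e₂ => .bindM (e₁.subst s) (e₂.subst s.lift)
  | _, _, _, s, .observe t u => .observe (t.subst s.lift) (u.subst s)
  | _, _, _, s, .infer e => .infer (e.subst s)
  | _, _, _, s, .ran e => .ran (e.subst s)
  | _, _, _, s, .bernoulli e => .bernoulli (e.subst s)
  | _, _, _, _, .uniform => .uniform
  | _, _, _, s, .beta e₁ e₂ => .beta (e₁.subst s) (e₂.subst s)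
  | _, _, _, s, .normal e₁ e₂ => .normal (e₁.subst s) (e₂.subst s)
  | _, _, _, s, .lapMech e₁ e₂ => .lapMech (e₁.subst s) (e₂.subst s)
  | _, _, _, s, .gaussMech e₁ e₂ => .gaussMech (e₁.subst s) (e₂.subst s)
  | _, _, _, s, .expMech e₁ e₂ e₃ => .expMech (e₁.subst s) (e₂.subst s) (e₃.subst s)

/-! ## Denotational semantics -/

/-- Valuations of a context. -/
abbrev Env (Γ : List Ty) : Type := ∀ ⦃τ : Ty⦄, Var Γ τ → τ.interp

def Env.nil : Env [] := fun _ x => nomatch x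

def Env.cons {Γ : List Ty} {σ : Ty} (d : σ.interp) (θ : Env Γ) : Env (σ :: Γ)
  | _, .zero => d
  | _, .succ x => θ x

def Env.tail {Γ : List Ty} {σ : Ty} (θ : Env (σ :: Γ)) : Env Γ := fun _ x => θ (.succ x)

/-- The parameters of the semantics: the precision of the discrete versions of continuous
distributions, the finite sets of outputs on which the discrete version of the exponential
mechanism ranges when its weights cannot be normalized on the whole type, and the inference
algorithm, which is exact and never fails. -/
structure Semantics where
  precision : ℕ+
  outputs : (k : VTy) → Finset k.interp
  algInf : (b : BTy) → PMF b.interp → SymDist b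
  algInf_exact : ∀ (b : BTy) (μ : PMF b.interp), (algInf b μ).ran precision = μ

/-- The recursive equation `g x = Φ g x` is terminating: along some well-founded order, the value
at `x` depends on the values of `g` at smaller arguments only. -/
def IsGuarded {α β : Type} (Φ : (α → β) → α → β) : Prop :=
  ∃ r : α → α → Prop, WellFounded r ∧
    ∀ (g g' : α → β) (x : α), (∀ y, r y x → g y = g' y) → Φ g x = Φ g' x

theorem IsGuarded.existsUnique {α β : Type} [Nonempty β] {Φ : (α → β) → α → β}
    (h : IsGuarded Φ) : ∃! g : α → β, Φ g = g := by
  classical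
  obtain ⟨r, wf, hr⟩ := h
  let F : (x : α) → ((y : α) → r y x → β) → β := fun x ih =>
    Φ (fun y => if hy : r y x then ih y hy else Classical.arbitrary β) x
  refine ⟨wf.fix F, ?_, ?_⟩
  · funext x
    rw [wf.fix_eq F x]
    refine hr _ _ x fun y hy => ?_
    simp [hy]
  · intro g hg
    funext x
    induction x using wf.induction with
    | _ x ih =>
      have h1 : wf.fix F x = Φ (wf.fix F) x := by
        conv_lhs => rw [wf.fix_eq F x]
        refine hr _ _ x fun y hy => ?_
        simp [hy]
      rw [h1, ← congrFun hg x]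
      exact hr _ _ x ih

open Classical in
/-- The function defined by a terminating recursive equation (and an arbitrary function if the
equation is not terminating). -/
def recFun {α β : Type} [Nonempty β] (Φ : (α → β) → α → β) : α → β :=
  if h : IsGuarded Φ then h.existsUnique.choose else fun _ => Classical.arbitrary β

/-- The discrete exponential mechanism: outputs are weighted by `exp (q r * ε / 2)`. -/
def expMechSem {α : Type} [Nonempty α] (R : Finset α) (ε : ℝ) (q : α → ℝ) : PMF α :=
  normalizeOr (fun r => ENNReal.ofReal (Real.exp (q r * ε / 2)))
    (normalizeOr ((R : Set α).indicator fun r => ENNReal.ofReal (Real.exp (q r * ε / 2)))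
      (PMF.pure (Classical.arbitrary α)))

/-- Filtering of the prior `u` by the likelihood `t` of the observation, followed by rescaling.
(An observation of probability zero has no meaning; it is ignored here.) -/
def observeSem {α : Type} (t : α → PMF Bool) (u : PMF α) : PMF α :=
  normalizeOr (fun d => u d * t d true) u

/-- The discrete Gaussian mechanism with standard deviation `s` on the value `x`. -/
def gaussMechSem (N : ℕ+) (s : ℝ≥0) (x : ℝ) : PMF ℝ :=
  discretize N (ProbabilityTheory.gaussianReal x (s ^ 2))

def boolCase {β : Type} (d : Bool) (y z : β) : β :=
  match d with
  | true => y
  | false => z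

def natCase {β : Type} (n : ℕ) (y : β) (z : ℕ → β) : β :=
  match n with
  | 0 => y
  | n + 1 => z n

def listCase {α β : Type} (l : List α) (y : β) (z : α → List α → β) : β :=
  match l with
  | [] => y
  | a :: l => z a l

/-- The denotation of an expression under a valuation. -/
def Tm.denote (S : Semantics) : {Γ : List Ty} → {τ : Ty} → Tm Γ τ → Env Γ → τ.interp
  | _, _, .var x, θ => θ x
  | _, _, .const c, _ => c
  | _, _, .app e₁ e₂, θ => (e₁.denote S θ) (e₂.denote S θ)
  | _, _, .lam e, θ => fun d => e.denote S (θ.cons d)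
  | _, _, .letrec e, θ => recFun fun g d => e.denote S ((θ.cons d).cons g)
  | _, _, .caseUnit _ e₁, θ => e₁.denote S θ
  | _, _, .caseBool e e₁ e₂, θ =>
      boolCase (e.denote S θ) (e₁.denote S θ) (e₂.denote S θ)
  | _, _, .caseNat e e₁ e₂, θ =>
      natCase (e.denote S θ) (e₁.denote S θ) fun n => e₂.denote S (θ.cons (σ := .nat) n)
  | _, _, .caseList (b := b) e e₁ e₂, θ =>
      listCase (α := b.interp) (e.denote S θ) (e₁.denote S θ)
        fun a l => e₂.denote S ((θ.cons (σ := .val (.base b)) a).cons (σ := .list b) l)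
  | _, _, .unitM (k := k) e, θ => PMF.pure (e.denote S θ : k.interp)
  | _, _, .bindM (k := k) (l := l) e₁ e₂, θ =>
      PMF.bind (e₁.denote S θ : PMF k.interp)
        fun d => (e₂.denote S (θ.cons (σ := .val k) d) : PMF l.interp)
  | _, _, .observe (b := b) t u, θ =>
      observeSem (fun d : b.interp => (t.denote S (θ.cons (σ := .val (.base b)) d) : PMF Bool))
        (u.denote S θ : PMF b.interp)
  | _, _, .infer (b := b) e, θ => S.algInf b (e.denote S θ)
  | _, _, .ran (b := b) e, θ => SymDist.ran S.precision (e.denote S θ : SymDist b)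
  | _, _, .bernoulli e, θ => SymDist.bernoulli (e.denote S θ)
  | _, _, .uniform, _ => SymDist.uniform
  | _, _, .beta e₁ e₂, θ => SymDist.beta (e₁.denote S θ) (e₂.denote S θ)
  | _, _, .normal e₁ e₂, θ => SymDist.normal (e₁.denote S θ) (e₂.denote S θ)
  | _, _, .lapMech e₁ e₂, θ =>
      discretize S.precision (laplaceMeasure (e₁.denote S θ) (e₂.denote S θ))
  | _, _, .gaussMech e₁ e₂, θ =>
      gaussMechSem S.precision (e₁.denote S θ) (e₂.denote S θ)
  | _, _, .expMech (k := k) e₁ e₂ e₃, θ =>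
      expMechSem (S.outputs k) (e₁.denote S θ : ℝ) ((e₂.denote S θ) (e₃.denote S θ))

/-! ## Relational types and assertions

A relational variable of simple type `τ` has a left and a right instance, both of type `τ`. In the
context of a relational expression they occupy two adjacent places: index `0` is the left instance
and index `1` is the right instance of the relational variable bound last. -/

mutual

/-- `RTy Ξ τ` is the set of relational types with erasure `τ` over the (plain, left and right)
variables `Ξ`. -/
inductive RTy : List Ty → Ty → Type
  /-- A basic type, or a type of symbolic distributions over a basic type. -/
  | val {Ξ} (k : VTy) : RTy Ξ (.val k)
  /-- The probability polymonad with indices `f` and `δ`. -/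
  | mon {Ξ k} (f : Tm Ξ .fn) (δ : Tm Ξ .ennreal) (T : RTy Ξ (.val k)) : RTy Ξ (.mon k)
  /-- The dependent product `Π (x :: T). U`. -/
  | pi {Ξ τ σ} (T : RTy Ξ τ) (U : RTy (τ :: τ :: Ξ) σ) : RTy Ξ (.arr τ σ)
  /-- The refinement `{x :: T | φ}`. -/
  | refine {Ξ τ} (T : RTy Ξ τ) (φ : Assertion (τ :: τ :: Ξ)) : RTy Ξ τ

/-- Relational assertions. -/
inductive Assertion : List Ty → Type
  | allP {Ξ} (τ : Ty) (φ : Assertion (τ :: Ξ)) : Assertion Ξ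
  | exP {Ξ} (τ : Ty) (φ : Assertion (τ :: Ξ)) : Assertion Ξ
  | allR {Ξ τ} (T : RTy Ξ τ) (φ : Assertion (τ :: τ :: Ξ)) : Assertion Ξ
  | exR {Ξ τ} (T : RTy Ξ τ) (φ : Assertion (τ :: τ :: Ξ)) : Assertion Ξ
  /-- A bound on the f-divergence of two symbolic distributions. -/
  | divSym {Ξ b} (f : Tm Ξ .fn) (e₁ e₂ : Tm Ξ (.val (.dist b))) (δ : Tm Ξ .ennreal) : Assertion Ξ
  /-- A bound on the f-divergence of two actual distributions. -/
  | div {Ξ k} (f : Tm Ξ .fn) (e₁ e₂ : Tm Ξ (.mon k)) (δ : Tm Ξ .ennreal) : Assertion Ξ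
  | inF {Ξ} (f : Tm Ξ .fn) : Assertion Ξ
  | eq {Ξ τ} (e₁ e₂ : Tm Ξ τ) : Assertion Ξ
  | le {Ξ τ} (e₁ e₂ : Tm Ξ τ) : Assertion Ξ
  | top {Ξ} : Assertion Ξ
  | bot {Ξ} : Assertion Ξ
  | not {Ξ} (φ : Assertion Ξ) : Assertion Ξ
  | or {Ξ} (φ ψ : Assertion Ξ) : Assertion Ξ
  | and {Ξ} (φ ψ : Assertion Ξ) : Assertion Ξ
  | imp {Ξ} (φ ψ : Assertion Ξ) : Assertion Ξ

end

mutual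

/-- Capture-avoiding substitution in relational types. -/
def RTy.subst : {Ξ Ξ' : List Ty} → {τ : Ty} → Subst Ξ Ξ' → RTy Ξ τ → RTy Ξ' τ
  | _, _, _, _, .val k => .val k
  | _, _, _, s, .mon f δ T => .mon (f.subst s) (δ.subst s) (T.subst s)
  | _, _, _, s, .pi T U => .pi (T.subst s) (U.subst s.lift.lift)
  | _, _, _, s, .refine T φ => .refine (T.subst s) (φ.subst s.lift.lift)

/-- Capture-avoiding substitution in assertions. -/
def Assertion.subst : {Ξ Ξ' : List Ty} → Subst Ξ Ξ' → Assertion Ξ → Assertion Ξ'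
  | _, _, s, .allP τ φ => .allP τ (φ.subst s.lift)
  | _, _, s, .exP τ φ => .exP τ (φ.subst s.lift)
  | _, _, s, .allR T φ => .allR (T.subst s) (φ.subst s.lift.lift)
  | _, _, s, .exR T φ => .exR (T.subst s) (φ.subst s.lift.lift)
  | _, _, s, .divSym f e₁ e₂ δ => .divSym (f.subst s) (e₁.subst s) (e₂.subst s) (δ.subst s)
  | _, _, s, .div f e₁ e₂ δ => .div (f.subst s) (e₁.subst s) (e₂.subst s) (δ.subst s)
  | _, _, s, .inF f => .inF (f.subst s)
  | _, _, s, .eq e₁ e₂ => .eq (e₁.subst s) (e₂.subst s)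
  | _, _, s, .le e₁ e₂ => .le (e₁.subst s) (e₂.subst s)
  | _, _, _, .top => .top
  | _, _, _, .bot => .bot
  | _, _, s, .not φ => .not (φ.subst s)
  | _, _, s, .or φ ψ => .or (φ.subst s) (ψ.subst s)
  | _, _, s, .and φ ψ => .and (φ.subst s) (ψ.subst s)
  | _, _, s, .imp φ ψ => .imp (φ.subst s) (ψ.subst s)

end

/-- Renaming of relational types. -/
def RTy.rename {Ξ Ξ' : List Ty} {τ : Ty} (ρ : Ren Ξ Ξ') (T : RTy Ξ τ) : RTy Ξ' τ :=
  T.subst fun _ x => .var (ρ x)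

/-- Weakening by the two instances of a relational variable. -/
def RTy.wk2 {Ξ : List Ty} {τ σ σ' : Ty} (T : RTy Ξ τ) : RTy (σ :: σ' :: Ξ) τ :=
  T.rename fun _ x => .succ (.succ x)

def Subst.nil {Ξ : List Ty} : Subst [] Ξ := fun _ x => nomatch x

/-- A closed relational type, used in any context. -/
def RTy.ofClosed {Ξ : List Ty} {τ : Ty} (T : RTy [] τ) : RTy Ξ τ :=
  T.subst Subst.nil

/-- The substitution of `a` and `a'` for the two instances of the last relational variable. -/
def Subst.inst {Ξ : List Ty} {τ : Ty} (a a' : Tm Ξ τ) : Subst (τ :: τ :: Ξ) Ξ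
  | _, .zero => a
  | _, .succ .zero => a'
  | _, .succ (.succ x) => .var x

/-- `U {x ↦ a}`, where the left instance of `x` is replaced by `a` and the right one by `a'`. -/
def RTy.inst {Ξ : List Ty} {τ σ : Ty} (U : RTy (τ :: τ :: Ξ) σ) (a a' : Tm Ξ τ) : RTy Ξ σ :=
  U.subst (Subst.inst a a')

mutual

/-- The relational interpretation of relational types. -/
def RTy.interp (S : Semantics) : {Ξ : List Ty} → {τ : Ty} → RTy Ξ τ → Env Ξ →
    τ.interp → τ.interp → Prop
  | _, _, .val _, _, _, _ => True
  | _, _, .mon (k := k) f δ T, θ, μ₁, μ₂ =>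
      Lifting (f.denote S θ) (δ.denote S θ) (fun d₁ d₂ : k.interp => T.interp S θ d₁ d₂) μ₁ μ₂
  | _, _, .pi T U, θ, f₁, f₂ =>
      ∀ d₁ d₂, T.interp S θ d₁ d₂ → U.interp S ((θ.cons d₂).cons d₁) (f₁ d₁) (f₂ d₂)
  | _, _, .refine T φ, θ, d₁, d₂ =>
      T.interp S θ d₁ d₂ ∧ φ.interp S ((θ.cons d₂).cons d₁)

/-- The interpretation of assertions. -/
def Assertion.interp (S : Semantics) : {Ξ : List Ty} → Assertion Ξ → Env Ξ → Prop
  | _, .allP _ φ, θ => ∀ d, φ.interp S (θ.cons d)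
  | _, .exP _ φ, θ => ∃ d, φ.interp S (θ.cons d)
  | _, .allR T φ, θ => ∀ d₁ d₂, T.interp S θ d₁ d₂ → φ.interp S ((θ.cons d₂).cons d₁)
  | _, .exR T φ, θ => ∃ d₁ d₂, T.interp S θ d₁ d₂ ∧ φ.interp S ((θ.cons d₂).cons d₁)
  | _, .divSym (b := b) f e₁ e₂ δ, θ =>
      AreClose (f.denote S θ) (δ.denote S θ) (SymDist.ran (b := b) S.precision (e₁.denote S θ))
        (SymDist.ran (b := b) S.precision (e₂.denote S θ))
  | _, .div (k := k) f e₁ e₂ δ, θ =>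
      AreClose (α := k.interp) (f.denote S θ) (δ.denote S θ) (e₁.denote S θ) (e₂.denote S θ)
  | _, .inF f, θ => FClass (f.denote S θ)
  | _, .eq e₁ e₂, θ => e₁.denote S θ = e₂.denote S θ
  | _, .le (τ := τ) e₁ e₂, θ => τ.le (e₁.denote S θ) (e₂.denote S θ)
  | _, .top, _ => True
  | _, .bot, _ => False
  | _, .not φ, θ => ¬ φ.interp S θ
  | _, .or φ ψ, θ => φ.interp S θ ∨ ψ.interp S θ
  | _, .and φ ψ, θ => φ.interp S θ ∧ ψ.interp S θ
  | _, .imp φ ψ, θ => φ.interp S θ → ψ.interp S θ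

end

/-! ## Relational environments -/

/-- The context of the left and right instances of the variables of `Γ`. -/
@[reducible] def dbl : List Ty → List Ty
  | [] => []
  | τ :: Γ => τ :: τ :: dbl Γ

/-- The left instance of a variable. -/
def Var.left : {Γ : List Ty} → {τ : Ty} → Var Γ τ → Var (dbl Γ) τ
  | _ :: _, _, .zero => .zero
  | _ :: _, _, .succ x => .succ (.succ x.left)

/-- The right instance of a variable. -/
def Var.right : {Γ : List Ty} → {τ : Ty} → Var Γ τ → Var (dbl Γ) τ
  | _ :: _, _, .zero => .succ .zero
  | _ :: _, _, .succ x => .succ (.succ x.right)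

/-- The expression with all its free variables replaced by their left instances. -/
def Tm.left {Γ : List Ty} {τ : Ty} (e : Tm Γ τ) : Tm (dbl Γ) τ := e.rename fun _ x => x.left

/-- The expression with all its free variables replaced by their right instances. -/
def Tm.right {Γ : List Ty} {τ : Ty} (e : Tm Γ τ) : Tm (dbl Γ) τ := e.rename fun _ x => x.right

/-- The valuation given by the left instances. -/
def Env.left {Γ : List Ty} (θ : Env (dbl Γ)) : Env Γ := fun _ x => θ x.left

/-- The valuation given by the right instances. -/
def Env.right {Γ : List Ty} (θ : Env (dbl Γ)) : Env Γ := fun _ x => θ x.right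

/-- Relational environments, indexed by their erasure: sequences of bindings `x :: T` and of
assumptions `{φ}` (which stand for bindings of a dummy variable of type `{_ :: unit | φ}`). -/
inductive REnv : List Ty → Type
  | nil : REnv []
  | cons {Γ τ} (G : REnv Γ) (T : RTy (dbl Γ) τ) : REnv (τ :: Γ)
  | assume {Γ} (G : REnv Γ) (φ : Assertion (dbl Γ)) : REnv Γ

/-- The relational type of a variable. -/
def REnv.get : {Γ : List Ty} → {τ : Ty} → REnv Γ → Var Γ τ → RTy (dbl Γ) τ
  | _, _, .cons _ T, .zero => T.wk2
  | _, _, .cons G _, .succ x => (G.get x).wk2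
  | _, _, .assume G _, x => G.get x

/-- `G.Valid S θ`: the valuation `θ` validates the relational environment `G`. -/
def REnv.Valid (S : Semantics) : {Γ : List Ty} → REnv Γ → Env (dbl Γ) → Prop
  | _, .nil, _ => True
  | _, .cons G T, θ =>
      G.Valid S (Env.tail (Env.tail θ)) ∧
        T.interp S (Env.tail (Env.tail θ)) (θ .zero) (θ (.succ .zero))
  | _, .assume G φ, θ => G.Valid S θ ∧ φ.interp S θ

/-! ## Relational subtyping and typing -/

/-- The type `{y :: k | y◁ = y▷}`. -/
def RTy.eqv {Ξ : List Ty} (k : VTy) : RTy Ξ (.val k) :=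
  .refine (.val k) (.eq (.var .zero) (.var (.succ .zero)))

/-- The expression `δ₁ + δ₂`. -/
def Tm.addE {Ξ : List Ty} (δ₁ δ₂ : Tm Ξ .ennreal) : Tm Ξ .ennreal :=
  .app (.app (.const (τ := .arr .ennreal (.arr .ennreal .ennreal))
    (fun (a b : ℝ≥0∞) => (a + b : ℝ≥0∞))) δ₁) δ₂

/-- The expression `succ e`. -/
def Tm.succE {Ξ : List Ty} (e : Tm Ξ .nat) : Tm Ξ .nat :=
  .app (.const (τ := .arr .nat .nat) (fun n : ℕ => (n + 1 : ℕ))) e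

/-- The expression `x :: l`. -/
def Tm.consE {Ξ : List Ty} {b : BTy} (x : Tm Ξ (.val (.base b))) (l : Tm Ξ (.list b)) :
    Tm Ξ (.list b) :=
  .app (.app (.const (τ := .arr (.val (.base b)) (.arr (.list b) (.list b)))
    (fun (a : b.interp) (l : List b.interp) => (a :: l : List b.interp))) x) l

abbrev Tm.boolE {Ξ : List Ty} (d : Bool) : Tm Ξ .bool := .const (τ := .bool) d

abbrev Tm.zeroE {Ξ : List Ty} : Tm Ξ .nat := .const (τ := .nat) (0 : ℕ)

abbrev Tm.nilE {Ξ : List Ty} {b : BTy} : Tm Ξ (.list b) :=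
  .const (τ := .list b) ([] : List b.interp)

/-- `RSub S G T U`: the relational subtyping judgment `G ⊢ T ≼ U`. -/
inductive RSub (S : Semantics) : {Γ : List Ty} → {τ : Ty} → REnv Γ → RTy (dbl Γ) τ →
    RTy (dbl Γ) τ → Prop
  | refl {Γ τ} {G : REnv Γ} (T : RTy (dbl Γ) τ) : RSub S G T T
  | trans {Γ τ} {G : REnv Γ} {T U V : RTy (dbl Γ) τ} (h₁ : RSub S G T U) (h₂ : RSub S G U V) :
      RSub S G T V
  /-- `G ⊢ {x :: T | φ} ≼ T` -/
  | left {Γ τ} {G : REnv Γ} (T : RTy (dbl Γ) τ) (φ : Assertion (τ :: τ :: dbl Γ)) :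
      RSub S G (.refine T φ) T
  /-- `G ⊢ T ≼ {x :: U | φ}` if `G ⊢ T ≼ U` and `φ` holds under all `θ ⊨ G, x :: T`. -/
  | right {Γ τ} {G : REnv Γ} {T U : RTy (dbl Γ) τ} {φ : Assertion (τ :: τ :: dbl Γ)}
      (h : RSub S G T U) (hφ : ∀ θ : Env (dbl (τ :: Γ)), (G.cons T).Valid S θ → φ.interp S θ) :
      RSub S G T (.refine U φ)
  | pi {Γ τ σ} {G : REnv Γ} {T₁ T₂ : RTy (dbl Γ) τ} {U₁ U₂ : RTy (τ :: τ :: dbl Γ) σ}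
      (hT : RSub S G T₂ T₁) (hU : RSub S (Γ := τ :: Γ) (G.cons T₂) U₁ U₂) :
      RSub S G (.pi T₁ U₁) (.pi T₂ U₂)
  /-- Monadic subtyping: the bound on the divergence may be weakened. -/
  | mon {Γ k} {G : REnv Γ} {T U : RTy (dbl Γ) (.val k)} {f₁ f₂ : Tm (dbl Γ) .fn}
      {δ₁ δ₂ : Tm (dbl Γ) .ennreal} (hT : RSub S G T U)
      (hf₁ : ∀ θ, G.Valid S θ → (Assertion.inF f₁).interp S θ)
      (hf₂ : ∀ θ, G.Valid S θ → (Assertion.inF f₂).interp S θ)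
      (h : ∀ θ : Env (dbl (.val k :: Γ)), (G.cons T).Valid S θ →
        IndexLe (f₁.denote S (Env.tail (Env.tail θ))) (δ₁.denote S (Env.tail (Env.tail θ)))
          (f₂.denote S (Env.tail (Env.tail θ))) (δ₂.denote S (Env.tail (Env.tail θ)))) :
      RSub S G (.mon f₁ δ₁ T) (.mon f₂ δ₂ U)

/-- The renaming that inserts the two instances of a variable just below the last relational
variable. -/
def Ren.under {Ξ : List Ty} {τ σ σ' : Ty} : Ren (τ :: τ :: Ξ) (τ :: τ :: σ :: σ' :: Ξ) :=
  Ren.lift (Ren.lift fun _ x => .succ (.succ x))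

/-- In an environment that binds `x :: T` last, the type `Π (y :: {y :: T | m y < m x}). U y` of the
recursive occurrence of a function of type `Π (x :: T). U x`, where `m` is a measure (a relational
expression in the left and right instance of the argument). -/
def RTy.recTy {Ξ : List Ty} {τ σ : Ty} (T : RTy Ξ τ) (U : RTy (τ :: τ :: Ξ) σ)
    (m : Tm (τ :: τ :: Ξ) .nat) : RTy (τ :: τ :: Ξ) (.arr τ σ) :=
  .pi (.refine T.wk2 (.le (Tm.succE (m.rename Ren.under)) m.wk2)) (U.rename Ren.under)

/-- `RTyping S G e₁ e₂ T`: the relational typing judgment `G ⊢ e₁ ∼ e₂ :: T`. The free variables of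
`e₁` stand for their left instances and those of `e₂` for their right instances. -/
inductive RTyping (S : Semantics) : {Γ : List Ty} → {τ : Ty} → REnv Γ → Tm Γ τ → Tm Γ τ →
    RTy (dbl Γ) τ → Prop
  | var {Γ τ} {G : REnv Γ} (x : Var Γ τ) : RTyping S G (.var x) (.var x) (G.get x)
  /-- A constant has each of the closed relational types that its value inhabits. -/
  | const {Γ τ} {G : REnv Γ} (c : τ.interp) (T : RTy [] τ) (h : T.interp S Env.nil c c) :
      RTyping S G (.const c) (.const c) T.ofClosed
  | abs {Γ τ σ} {G : REnv Γ} {e₁ e₂ : Tm (τ :: Γ) σ} {T : RTy (dbl Γ) τ}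
      {U : RTy (τ :: τ :: dbl Γ) σ} (h : RTyping S (G.cons T) e₁ e₂ U) :
      RTyping S G (.lam e₁) (.lam e₂) (.pi T U)
  | app {Γ τ σ} {G : REnv Γ} {e₁ e₂ : Tm Γ (.arr τ σ)} {a₁ a₂ : Tm Γ τ} {T : RTy (dbl Γ) τ}
      {U : RTy (τ :: τ :: dbl Γ) σ} (he : RTyping S G e₁ e₂ (.pi T U))
      (ha : RTyping S G a₁ a₂ T) :
      RTyping S G (.app e₁ a₁) (.app e₂ a₂) (U.inst a₁.left a₂.right)
  /-- Terminating recursion: recursive calls are made on arguments of smaller measure. -/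
  | letrec {Γ τ σ} {G : REnv Γ} {e₁ e₂ : Tm (.arr τ σ :: τ :: Γ) σ} {T : RTy (dbl Γ) τ}
      {U : RTy (τ :: τ :: dbl Γ) σ} (m : Tm (τ :: τ :: dbl Γ) .nat)
      (hguard : ∀ θ, G.Valid S θ →
        IsGuarded (fun g d => e₁.denote S ((Env.left θ |>.cons d).cons (σ := .arr τ σ) g)) ∧
        IsGuarded (fun g d => e₂.denote S ((Env.right θ |>.cons d).cons (σ := .arr τ σ) g)))
      (h : RTyping S ((G.cons T).cons (T.recTy U m)) e₁ e₂ U.wk2) :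
      RTyping S G (.letrec e₁) (.letrec e₂) (.pi T U)
  | sub {Γ τ} {G : REnv Γ} {e₁ e₂ : Tm Γ τ} {T U : RTy (dbl Γ) τ} (h : RTyping S G e₁ e₂ T)
      (hs : RSub S G T U) : RTyping S G e₁ e₂ U
  /-- An expression may be used to refine its own type. -/
  | self {Γ τ} {G : REnv Γ} {e₁ e₂ : Tm Γ τ} {T : RTy (dbl Γ) τ} (h : RTyping S G e₁ e₂ T) :
      RTyping S G e₁ e₂
        (.refine T (.and (.eq (.var .zero) e₁.left.wk2) (.eq (.var (.succ .zero)) e₂.right.wk2)))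
  /-- Expressions may be replaced by expressions with the same denotation, e.g. by reduction. -/
  | conv {Γ τ} {G : REnv Γ} {e₁ e₂ e₁' e₂' : Tm Γ τ} {T : RTy (dbl Γ) τ}
      (h₁ : ∀ θ, G.Valid S θ → e₁.denote S (Env.left θ) = e₁'.denote S (Env.left θ))
      (h₂ : ∀ θ, G.Valid S θ → e₂.denote S (Env.right θ) = e₂'.denote S (Env.right θ))
      (h : RTyping S G e₁' e₂' T) : RTyping S G e₁ e₂ T
  | caseUnit {Γ σ} {G : REnv Γ} {e e' : Tm Γ .unit} {e₁ e₁' : Tm Γ σ} {V : RTy (dbl Γ) .unit}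
      {T : RTy (dbl Γ) σ} (he : RTyping S G e e' V) (h₁ : RTyping S G e₁ e₁' T) :
      RTyping S G (.caseUnit e e₁) (.caseUnit e' e₁') T
  /-- Case analysis on scrutinees that take the same branch in the two runs. -/
  | caseBool {Γ σ} {G : REnv Γ} {e e' : Tm Γ .bool} {e₁ e₂ e₁' e₂' : Tm Γ σ}
      {V : RTy (dbl Γ) .bool} {T : RTy (dbl Γ) σ} (he : RTyping S G e e' V)
      (hsync : ∀ θ, G.Valid S θ → (@Eq Bool (e.denote S (Env.left θ)) true ↔
        @Eq Bool (e'.denote S (Env.right θ)) true))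
      (h₁ : RTyping S (G.assume (.and (.eq e.left (Tm.boolE true)) (.eq e'.right (Tm.boolE true))))
        e₁ e₁' T)
      (h₂ : RTyping S
        (G.assume (.and (.eq e.left (Tm.boolE false)) (.eq e'.right (Tm.boolE false)))) e₂ e₂' T) :
      RTyping S G (.caseBool e e₁ e₂) (.caseBool e' e₁' e₂') T
  | caseNat {Γ σ} {G : REnv Γ} {e e' : Tm Γ .nat} {e₁ e₁' : Tm Γ σ} {e₂ e₂' : Tm (.nat :: Γ) σ}
      {V : RTy (dbl Γ) .nat} {T : RTy (dbl Γ) σ} (he : RTyping S G e e' V)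
      (hsync : ∀ θ, G.Valid S θ → (@Eq ℕ (e.denote S (Env.left θ)) 0 ↔
        @Eq ℕ (e'.denote S (Env.right θ)) 0))
      (h₁ : RTyping S (G.assume (.and (.eq e.left Tm.zeroE) (.eq e'.right Tm.zeroE))) e₁ e₁' T)
      (h₂ : RTyping S ((G.cons (.val (.base .nat))).assume
        (.and (.eq e.left.wk2 (Tm.succE (.var .zero)))
          (.eq e'.right.wk2 (Tm.succE (.var (.succ .zero)))))) e₂ e₂' T.wk2) :
      RTyping S G (.caseNat e e₁ e₂) (.caseNat e' e₁' e₂') T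
  | caseList {Γ b σ} {G : REnv Γ} {e e' : Tm Γ (.list b)} {e₁ e₁' : Tm Γ σ}
      {e₂ e₂' : Tm (.list b :: .val (.base b) :: Γ) σ} {V : RTy (dbl Γ) (.list b)}
      {T : RTy (dbl Γ) σ} (he : RTyping S G e e' V)
      (hsync : ∀ θ, G.Valid S θ → (@Eq (List b.interp) (e.denote S (Env.left θ)) [] ↔
        @Eq (List b.interp) (e'.denote S (Env.right θ)) []))
      (h₁ : RTyping S (G.assume (.and (.eq e.left Tm.nilE) (.eq e'.right Tm.nilE))) e₁ e₁' T)
      (h₂ : RTyping S (((G.cons (.val (.base b))).cons (.val (.base (.list b)))).assume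
        (.and (.eq e.left.wk2.wk2 (Tm.consE (.var (.succ (.succ .zero))) (.var .zero)))
          (.eq e'.right.wk2.wk2
            (Tm.consE (.var (.succ (.succ (.succ .zero)))) (.var (.succ .zero))))))
        e₂ e₂' T.wk2.wk2) :
      RTyping S G (.caseList e e₁ e₂) (.caseList e' e₁' e₂') T
  /-- Case analysis in the left run only. -/
  | caseBoolL {Γ σ} {G : REnv Γ} {e : Tm Γ .bool} {e₁ e₂ e' : Tm Γ σ} {T : RTy (dbl Γ) σ}
      (h₁ : RTyping S (G.assume (.eq e.left (Tm.boolE true))) e₁ e' T)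
      (h₂ : RTyping S (G.assume (.eq e.left (Tm.boolE false))) e₂ e' T) :
      RTyping S G (.caseBool e e₁ e₂) e' T
  | caseNatL {Γ σ} {G : REnv Γ} {e : Tm Γ .nat} {e₁ e' : Tm Γ σ} {e₂ : Tm (.nat :: Γ) σ}
      {T : RTy (dbl Γ) σ} (h₁ : RTyping S (G.assume (.eq e.left Tm.zeroE)) e₁ e' T)
      (h₂ : RTyping S ((G.cons (.val (.base .nat))).assume
        (.eq e.left.wk2 (Tm.succE (.var .zero)))) e₂ e'.wk T.wk2) :
      RTyping S G (.caseNat e e₁ e₂) e' T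
  | caseListL {Γ b σ} {G : REnv Γ} {e : Tm Γ (.list b)} {e₁ e' : Tm Γ σ}
      {e₂ : Tm (.list b :: .val (.base b) :: Γ) σ} {T : RTy (dbl Γ) σ}
      (h₁ : RTyping S (G.assume (.eq e.left Tm.nilE)) e₁ e' T)
      (h₂ : RTyping S (((G.cons (.val (.base b))).cons (.val (.base (.list b)))).assume
        (.eq e.left.wk2.wk2 (Tm.consE (.var (.succ (.succ .zero))) (.var .zero))))
        e₂ e'.wk.wk T.wk2.wk2) :
      RTyping S G (.caseList e e₁ e₂) e' T
  /-- Case analysis in the right run only. -/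
  | caseBoolR {Γ σ} {G : REnv Γ} {e : Tm Γ .bool} {e₁ e₂ e' : Tm Γ σ} {T : RTy (dbl Γ) σ}
      (h₁ : RTyping S (G.assume (.eq e.right (Tm.boolE true))) e' e₁ T)
      (h₂ : RTyping S (G.assume (.eq e.right (Tm.boolE false))) e' e₂ T) :
      RTyping S G e' (.caseBool e e₁ e₂) T
  | caseNatR {Γ σ} {G : REnv Γ} {e : Tm Γ .nat} {e₁ e' : Tm Γ σ} {e₂ : Tm (.nat :: Γ) σ}
      {T : RTy (dbl Γ) σ} (h₁ : RTyping S (G.assume (.eq e.right Tm.zeroE)) e' e₁ T)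
      (h₂ : RTyping S ((G.cons (.val (.base .nat))).assume
        (.eq e.right.wk2 (Tm.succE (.var (.succ .zero))))) e'.wk e₂ T.wk2) :
      RTyping S G e' (.caseNat e e₁ e₂) T
  | caseListR {Γ b σ} {G : REnv Γ} {e : Tm Γ (.list b)} {e₁ e' : Tm Γ σ}
      {e₂ : Tm (.list b :: .val (.base b) :: Γ) σ} {T : RTy (dbl Γ) σ}
      (h₁ : RTyping S (G.assume (.eq e.right Tm.nilE)) e' e₁ T)
      (h₂ : RTyping S (((G.cons (.val (.base b))).cons (.val (.base (.list b)))).assume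
        (.eq e.right.wk2.wk2
          (Tm.consE (.var (.succ (.succ (.succ .zero)))) (.var (.succ .zero)))))
        e'.wk.wk e₂ T.wk2.wk2) :
      RTyping S G e' (.caseList e e₁ e₂) T
  | unitM {Γ k} {G : REnv Γ} {e₁ e₂ : Tm Γ (.val k)} {T : RTy (dbl Γ) (.val k)}
      {f : Tm (dbl Γ) .fn} {δ : Tm (dbl Γ) .ennreal}
      (hf : ∀ θ, G.Valid S θ → (Assertion.inF f).interp S θ) (h : RTyping S G e₁ e₂ T) :
      RTyping S G (.unitM e₁) (.unitM e₂) (.mon f δ T)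
  | bindM {Γ k l} {G : REnv Γ} {e₁ e₁' : Tm Γ (.mon k)} {e₂ e₂' : Tm (.val k :: Γ) (.mon l)}
      {T₁ : RTy (dbl Γ) (.val k)} {T₂ : RTy (dbl Γ) (.val l)} {f₁ f₂ f₃ : Tm (dbl Γ) .fn}
      {δ₁ δ₂ : Tm (dbl Γ) .ennreal} (h₁ : RTyping S G e₁ e₁' (.mon f₁ δ₁ T₁))
      (hcomp : ∀ θ, G.Valid S θ →
        Composable (f₁.denote S θ) (f₂.denote S θ) (f₃.denote S θ))
      (h₂ : RTyping S (G.cons T₁) e₂ e₂' (RTy.mon f₂ δ₂ T₂).wk2) :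
      RTyping S G (.bindM e₁ e₂) (.bindM e₁' e₂') (.mon f₃ (Tm.addE δ₁ δ₂) T₂)
  | infer {Γ b} {G : REnv Γ} {e₁ e₂ : Tm Γ (.mon (.base b))} {f : Tm (dbl Γ) .fn}
      {δ : Tm (dbl Γ) .ennreal} (h : RTyping S G e₁ e₂ (.mon f δ (.eqv (.base b)))) :
      RTyping S G (.infer e₁) (.infer e₂)
        (.refine (.val (.dist b)) (.divSym f.wk2 (.var .zero) (.var (.succ .zero)) δ.wk2))
  | ran {Γ b} {G : REnv Γ} {e₁ e₂ : Tm Γ (.val (.dist b))} {f : Tm (dbl Γ) .fn}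
      {δ : Tm (dbl Γ) .ennreal}
      (h : RTyping S G e₁ e₂
        (.refine (.val (.dist b)) (.divSym f.wk2 (.var .zero) (.var (.succ .zero)) δ.wk2))) :
      RTyping S G (.ran e₁) (.ran e₂) (.mon f δ (.eqv (.base b)))
  /-- In `observe x ⇒ t in u`, the divergence of the two posteriors is bounded by `δ''`. -/
  | observe {Γ b} {G : REnv Γ} {t₁ t₂ : Tm (.val (.base b) :: Γ) (.mon (.base .bool))}
      {u₁ u₂ : Tm Γ (.mon (.base b))} {f : Tm (dbl Γ) .fn} {δ δ'' : Tm (dbl Γ) .ennreal}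
      {δ' : Tm (dbl (.val (.base b) :: Γ)) .ennreal}
      (hu : RTyping S G u₁ u₂ (.mon f δ (.eqv (.base b))))
      (ht : RTyping S (G.cons (.val (.base b))) t₁ t₂ (.mon f.wk2 δ' (.eqv (.base .bool))))
      (hdiv : ∀ θ, G.Valid S θ →
        (Assertion.div f (Tm.observe t₁ u₁).left (Tm.observe t₂ u₂).right δ'').interp S θ) :
      RTyping S G (.observe t₁ u₁) (.observe t₂ u₂) (.mon f δ'' (.eqv (.base b)))
  | bernoulli {Γ} {G : REnv Γ} {e₁ e₂ : Tm Γ .unitI} {T : RTy (dbl Γ) .unitI}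
      (h : RTyping S G e₁ e₂ T) :
      RTyping S G (.bernoulli e₁) (.bernoulli e₂) (.val (.dist .bool))
  | uniform {Γ} {G : REnv Γ} : RTyping S G .uniform .uniform (.val (.dist .unitI))
  | beta {Γ} {G : REnv Γ} {a₁ a₂ b₁ b₂ : Tm Γ .nnreal} {T U : RTy (dbl Γ) .nnreal}
      (ha : RTyping S G a₁ a₂ T) (hb : RTyping S G b₁ b₂ U) :
      RTyping S G (.beta a₁ b₁) (.beta a₂ b₂) (.val (.dist .unitI))
  | normal {Γ} {G : REnv Γ} {a₁ a₂ : Tm Γ .real} {b₁ b₂ : Tm Γ .nnreal} {T : RTy (dbl Γ) .real}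
      {U : RTy (dbl Γ) .nnreal} (ha : RTyping S G a₁ a₂ T) (hb : RTyping S G b₁ b₂ U) :
      RTyping S G (.normal a₁ b₁) (.normal a₂ b₂) (.val (.dist .real))
  /-- For the mechanisms, as for `observe`, the bound on the divergence is a premise. -/
  | lapMech {Γ} {G : REnv Γ} {a₁ a₂ : Tm Γ .nnreal} {b₁ b₂ : Tm Γ .real}
      {T : RTy (dbl Γ) .nnreal} {U : RTy (dbl Γ) .real} {f : Tm (dbl Γ) .fn}
      {δ : Tm (dbl Γ) .ennreal} (ha : RTyping S G a₁ a₂ T) (hb : RTyping S G b₁ b₂ U)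
      (hdiv : ∀ θ, G.Valid S θ →
        (Assertion.div f (Tm.lapMech a₁ b₁).left (Tm.lapMech a₂ b₂).right δ).interp S θ) :
      RTyping S G (.lapMech a₁ b₁) (.lapMech a₂ b₂) (.mon f δ (.eqv (.base .real)))
  | gaussMech {Γ} {G : REnv Γ} {a₁ a₂ : Tm Γ .nnreal} {b₁ b₂ : Tm Γ .real}
      {T : RTy (dbl Γ) .nnreal} {U : RTy (dbl Γ) .real} {f : Tm (dbl Γ) .fn}
      {δ : Tm (dbl Γ) .ennreal} (ha : RTyping S G a₁ a₂ T) (hb : RTyping S G b₁ b₂ U)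
      (hdiv : ∀ θ, G.Valid S θ →
        (Assertion.div f (Tm.gaussMech a₁ b₁).left (Tm.gaussMech a₂ b₂).right δ).interp S θ) :
      RTyping S G (.gaussMech a₁ b₁) (.gaussMech a₂ b₂) (.mon f δ (.eqv (.base .real)))
  | expMech {Γ τ k} {G : REnv Γ} {a₁ a₂ : Tm Γ .real}
      {q₁ q₂ : Tm Γ (.arr τ (.arr (.val k) .real))} {d₁ d₂ : Tm Γ τ} {T : RTy (dbl Γ) .real}
      {Q : RTy (dbl Γ) (.arr τ (.arr (.val k) .real))} {U : RTy (dbl Γ) τ} {f : Tm (dbl Γ) .fn}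
      {δ : Tm (dbl Γ) .ennreal} (ha : RTyping S G a₁ a₂ T) (hq : RTyping S G q₁ q₂ Q)
      (hd : RTyping S G d₁ d₂ U)
      (hdiv : ∀ θ, G.Valid S θ →
        (Assertion.div f (Tm.expMech a₁ q₁ d₁).left (Tm.expMech a₂ q₂ d₂).right δ).interp S θ) :
      RTyping S G (.expMech a₁ q₁ d₁) (.expMech a₂ q₂ d₂) (.mon f δ (.eqv k))

end PrivInfer

end

/-!
The theorem is the fundamental lemma of a binary logical relation, proved by induction on the typing
derivation (`RTyping.sound`) after the same for subtyping (`RSub.sound`). Dependent types are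
handled by the substitution lemma `RTy.interp_subst`: substituting in a relational type amounts to
changing the valuation. Each rule then reduces to a semantic fact about its construct.

* `unitM`, `bindM` and monadic subtyping: liftings contain pairs of point masses (`Lifting.pure`),
  compose (`Lifting.bind`), and are monotone in the relation and in the indices (`Lifting.mono`).
  For the composition, a witness of the lifting of the first computation is bound to a choice of
  witnesses of the liftings of the second, and composability bounds the divergence of the result.
* `infer`, `ran`, `observe` and the mechanisms: a lifting of equality is the same as a bound on the
  divergence (`lifting_eq_iff`), since its witnesses live on the diagonal, whose embedding preserves
  divergences. For `infer` the exactness of the inference algorithm is used in addition.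
* `letrec`: terminating recursive functions satisfy their equations, and are related by induction on
  the measure of the pair of arguments (`recFun_related`).
* Case analysis: the branch is determined by the value of the scrutinee, which also provides the
  values of the variables bound by the pattern.
-/

namespace PrivInfer

/-! ### Renaming and substitution in expressions -/

/-- The valuation of `Γ` that interprets each variable by the denotation of the expression
substituted for it. -/
noncomputable def Subst.eval (S : Semantics) {Γ Δ : List Ty} (s : Subst Γ Δ) (θ : Env Δ) : Env Γ :=
  fun _ x => (s x).denote S θ

theorem Env.cons_comp_lift {Γ Δ : List Ty} {σ : Ty} (ρ : Ren Γ Δ) (θ : Env Δ) (d : σ.interp) :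
    (fun _ x => θ.cons d (ρ.lift x) : Env (σ :: Γ)) = Env.cons d fun _ x => θ (ρ x) := by
  funext τ x
  cases x <;> rfl

theorem Tm.denote_rename (S : Semantics) {Γ Δ : List Ty} {τ : Ty} (e : Tm Γ τ) (ρ : Ren Γ Δ)
    (θ : Env Δ) : (e.rename ρ).denote S θ = e.denote S fun _ x => θ (ρ x) := by
  induction e generalizing Δ <;>
    simp only [Tm.rename, Tm.denote, Env.cons_comp_lift, *]

theorem Tm.denote_wk (S : Semantics) {Γ : List Ty} {τ σ : Ty} (e : Tm Γ τ) (θ : Env Γ)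
    (d : σ.interp) : e.wk.denote S (θ.cons d) = e.denote S θ :=
  e.denote_rename S _ _

theorem Tm.denote_wk2 (S : Semantics) {Γ : List Ty} {τ σ σ' : Ty} (e : Tm Γ τ) (θ : Env Γ)
    (d : σ.interp) (d' : σ'.interp) :
    e.wk2.denote S ((θ.cons d').cons d) = e.denote S θ :=
  e.denote_rename S _ _

theorem Tm.denote_left (S : Semantics) {Γ : List Ty} {τ : Ty} (e : Tm Γ τ) (θ : Env (dbl Γ)) :
    e.left.denote S θ = e.denote S (Env.left θ) :=
  e.denote_rename S _ _

theorem Tm.denote_right (S : Semantics) {Γ : List Ty} {τ : Ty} (e : Tm Γ τ) (θ : Env (dbl Γ)) :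
    e.right.denote S θ = e.denote S (Env.right θ) :=
  e.denote_rename S _ _

theorem Subst.eval_lift (S : Semantics) {Γ Δ : List Ty} {σ : Ty} (s : Subst Γ Δ) (θ : Env Δ)
    (d : σ.interp) : s.lift.eval S (θ.cons d) = (s.eval S θ).cons d := by
  funext τ x
  cases x
  · rfl
  · exact Tm.denote_wk S _ θ d

theorem Tm.denote_subst (S : Semantics) {Γ Δ : List Ty} {τ : Ty} (e : Tm Γ τ) (s : Subst Γ Δ)
    (θ : Env Δ) : (e.subst s).denote S θ = e.denote S (s.eval S θ) := by
  induction e generalizing Δ <;>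
    simp only [Tm.subst, Tm.denote, Subst.eval_lift, *]
  rfl

/-! ### Substitution in relational types and assertions -/

mutual

/-- Substitution in a relational type amounts to changing the valuation. -/
theorem RTy.interp_subst (S : Semantics) : {Ξ Ξ' : List Ty} → {τ : Ty} → (T : RTy Ξ τ) →
    (s : Subst Ξ Ξ') → (θ : Env Ξ') → (T.subst s).interp S θ = T.interp S (s.eval S θ)
  | _, _, _, .val _, s, θ => by funext d₁ d₂; simp only [RTy.subst, RTy.interp]
  | _, _, _, .mon f δ T, s, θ => by
    funext d₁ d₂
    simp only [RTy.subst, RTy.interp, Tm.denote_subst, T.interp_subst S s]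
  | _, _, _, .pi T U, s, θ => by
    funext d₁ d₂
    simp only [RTy.subst, RTy.interp, T.interp_subst S s, U.interp_subst S s.lift.lift,
      Subst.eval_lift]
  | _, _, _, .refine T φ, s, θ => by
    funext d₁ d₂
    simp only [RTy.subst, RTy.interp, T.interp_subst S s, φ.interp_subst S s.lift.lift,
      Subst.eval_lift]

/-- Substitution in an assertion amounts to changing the valuation. -/
theorem Assertion.interp_subst (S : Semantics) : {Ξ Ξ' : List Ty} → (φ : Assertion Ξ) →
    (s : Subst Ξ Ξ') → (θ : Env Ξ') → (φ.subst s).interp S θ = φ.interp S (s.eval S θ)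
  | _, _, .allP _ φ, s, θ => by
    simp only [Assertion.subst, Assertion.interp, φ.interp_subst S s.lift, Subst.eval_lift]
  | _, _, .exP _ φ, s, θ => by
    simp only [Assertion.subst, Assertion.interp, φ.interp_subst S s.lift, Subst.eval_lift]
  | _, _, .allR T φ, s, θ => by
    simp only [Assertion.subst, Assertion.interp, T.interp_subst S s,
      φ.interp_subst S s.lift.lift, Subst.eval_lift]
  | _, _, .exR T φ, s, θ => by
    simp only [Assertion.subst, Assertion.interp, T.interp_subst S s,
      φ.interp_subst S s.lift.lift, Subst.eval_lift]
  | _, _, .divSym .., s, θ => by simp only [Assertion.subst, Assertion.interp, Tm.denote_subst]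
  | _, _, .div .., s, θ => by simp only [Assertion.subst, Assertion.interp, Tm.denote_subst]
  | _, _, .inF _, s, θ => by simp only [Assertion.subst, Assertion.interp, Tm.denote_subst]
  | _, _, .eq .., s, θ => by simp only [Assertion.subst, Assertion.interp, Tm.denote_subst]
  | _, _, .le .., s, θ => by simp only [Assertion.subst, Assertion.interp, Tm.denote_subst]
  | _, _, .top, s, θ => by simp only [Assertion.subst, Assertion.interp]
  | _, _, .bot, s, θ => by simp only [Assertion.subst, Assertion.interp]
  | _, _, .not φ, s, θ => by simp only [Assertion.subst, Assertion.interp, φ.interp_subst S s]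
  | _, _, .or φ ψ, s, θ => by
    simp only [Assertion.subst, Assertion.interp, φ.interp_subst S s, ψ.interp_subst S s]
  | _, _, .and φ ψ, s, θ => by
    simp only [Assertion.subst, Assertion.interp, φ.interp_subst S s, ψ.interp_subst S s]
  | _, _, .imp φ ψ, s, θ => by
    simp only [Assertion.subst, Assertion.interp, φ.interp_subst S s, ψ.interp_subst S s]

end

theorem RTy.interp_rename (S : Semantics) {Ξ Ξ' : List Ty} {τ : Ty} (T : RTy Ξ τ) (ρ : Ren Ξ Ξ')
    (θ : Env Ξ') : (T.rename ρ).interp S θ = T.interp S fun _ x => θ (ρ x) :=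
  T.interp_subst S _ θ

theorem RTy.interp_wk2 (S : Semantics) {Ξ : List Ty} {τ σ σ' : Ty} (T : RTy Ξ τ)
    (θ : Env (σ :: σ' :: Ξ)) : T.wk2.interp S θ = T.interp S (Env.tail (Env.tail θ)) :=
  T.interp_rename S _ θ

theorem RTy.interp_inst (S : Semantics) {Ξ : List Ty} {τ σ : Ty} (U : RTy (τ :: τ :: Ξ) σ)
    (a a' : Tm Ξ τ) (θ : Env Ξ) :
    (U.inst a a').interp S θ = U.interp S ((θ.cons (a'.denote S θ)).cons (a.denote S θ)) := by
  rw [RTy.inst, RTy.interp_subst]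
  congr 1
  funext σ x
  rcases x with _ | _ | _ <;> rfl

theorem RTy.interp_ofClosed (S : Semantics) {Ξ : List Ty} {τ : Ty} (T : RTy [] τ) (θ : Env Ξ) :
    (T.ofClosed : RTy Ξ τ).interp S θ = T.interp S Env.nil := by
  rw [RTy.ofClosed, RTy.interp_subst]
  congr 1
  funext σ x
  cases x

/-! ### Valuations of left and right instances -/

theorem Env.left_cons {Γ : List Ty} {τ : Ty} (θ : Env (dbl Γ)) (d₁ d₂ : τ.interp) :
    Env.left (Γ := τ :: Γ) ((θ.cons d₂).cons d₁) = (Env.left θ).cons d₁ := by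
  funext σ x
  cases x <;> rfl

theorem Env.right_cons {Γ : List Ty} {τ : Ty} (θ : Env (dbl Γ)) (d₁ d₂ : τ.interp) :
    Env.right (Γ := τ :: Γ) ((θ.cons d₂).cons d₁) = (Env.right θ).cons d₂ := by
  funext σ x
  cases x <;> rfl

theorem REnv.valid_cons (S : Semantics) {Γ : List Ty} {τ : Ty} {G : REnv Γ} {T : RTy (dbl Γ) τ}
    {θ : Env (dbl Γ)} {d₁ d₂ : τ.interp} (hθ : G.Valid S θ) (hd : T.interp S θ d₁ d₂) :
    (G.cons T).Valid S ((θ.cons d₂).cons d₁) :=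
  ⟨hθ, hd⟩

theorem REnv.interp_get (S : Semantics) {Γ : List Ty} {τ : Ty} (G : REnv Γ) (x : Var Γ τ)
    (θ : Env (dbl Γ)) (hθ : G.Valid S θ) : (G.get x).interp S θ (θ x.left) (θ x.right) := by
  induction G with
  | nil => cases x
  | cons G T ih =>
    cases x with
    | zero =>
      rw [REnv.get, RTy.interp_wk2]
      exact hθ.2
    | succ x =>
      rw [REnv.get, RTy.interp_wk2]
      exact ih x _ hθ.1
  | assume G φ ih => exact ih x θ hθ.1

/-! ### Divergences -/

section Divergence

variable {α β : Type}

@[simp]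
theorem divTerm_zero_zero (f : ℝ≥0 → ℝ) : divTerm f 0 0 = 0 := by
  simp [divTerm]

/-- The values at `0` and at infinity are limits, so that only the values of the functions on the
positive reals are compared. -/
theorem divTerm_mono {f g : ℝ≥0 → ℝ} (h : ∀ x, 0 < x → f x ≤ g x) (a b : ℝ≥0) :
    divTerm f a b ≤ divTerm g a b := by
  unfold divTerm
  split_ifs with hb ha ha
  · exact le_rfl
  · refine mul_le_mul_of_nonneg_left (Filter.limsup_le_limsup ?_) (by simp)
    filter_upwards [Filter.eventually_gt_atTop 0] with u hu
    exact EReal.coe_le_coe_iff.2 (div_le_div_of_nonneg_right (h u hu) u.2)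
  · refine mul_le_mul_of_nonneg_left (Filter.limsup_le_limsup ?_) (by simp)
    filter_upwards [self_mem_nhdsWithin] with u hu
    exact EReal.coe_le_coe_iff.2 (h u hu)
  · exact EReal.coe_le_coe_iff.2
      (mul_le_mul_of_nonneg_left (h _ (div_pos (pos_iff_ne_zero.2 ha) (pos_iff_ne_zero.2 hb))) b.2)

theorem fDiv_mono {f g : ℝ≥0 → ℝ} (h : ∀ x, 0 < x → f x ≤ g x) (μ₁ μ₂ : PMF α) :
    fDiv f μ₁ μ₂ ≤ fDiv g μ₁ μ₂ := by
  refine EReal.sub_le_sub ?_ ?_ <;> refine EReal.coe_ennreal_le_coe_ennreal_iff.2 ?_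
  · exact ENNReal.tsum_le_tsum fun a => EReal.toENNReal_le_toENNReal (divTerm_mono h _ _)
  · exact ENNReal.tsum_le_tsum fun a =>
      EReal.toENNReal_le_toENNReal (EReal.neg_le_neg_iff.2 (divTerm_mono h _ _))

theorem fDiv_self {f : ℝ≥0 → ℝ} (hf : FClass f) (μ : PMF α) : fDiv f μ μ = 0 := by
  have h : ∀ a : ℝ≥0, divTerm f a a = 0 := fun a => by
    by_cases ha : a = 0 <;> simp [divTerm, ha, hf.2]
  simp [fDiv, h]

theorem map_apply_of_injective {i : α → β} (hi : i.Injective) (μ : PMF α) (a : α) :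
    μ.map i (i a) = μ a := by
  classical
  rw [PMF.map_apply, tsum_eq_single a]
  · simp
  · exact fun b hb => if_neg fun h => hb (hi h).symm

/-- Divergences are invariant under injective relabelling: outside the range of the relabelling
both masses vanish, and `0 * f (0 / 0) = 0`. -/
theorem fDiv_map_of_injective {i : α → β} (hi : i.Injective) (f : ℝ≥0 → ℝ) (μ₁ μ₂ : PMF α) :
    fDiv f (μ₁.map i) (μ₂.map i) = fDiv f μ₁ μ₂ := by
  have h0 : ∀ (μ : PMF α) b, b ∉ Set.range i → μ.map i b = 0 := fun μ b hb => by
    rw [PMF.apply_eq_zero_iff, PMF.support_map]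
    exact fun ⟨a, _, h⟩ => hb ⟨a, h⟩
  have h : ∀ F : EReal → ℝ≥0∞, F 0 = 0 →
      ∑' b, F (divTerm f (μ₁.map i b).toNNReal (μ₂.map i b).toNNReal) =
        ∑' a, F (divTerm f (μ₁ a).toNNReal (μ₂ a).toNNReal) := fun F hF => by
    rw [← hi.tsum_eq]
    · simp only [map_apply_of_injective hi]
    · intro b hb
      by_contra hb'
      exact hb (by simp [h0 _ b hb', hF])
  rw [fDiv, fDiv, h EReal.toENNReal (by simp), h (fun x => (-x).toENNReal) (by simp)]

/-! ### Liftings -/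

theorem Lifting.mono {f g : ℝ≥0 → ℝ} {δ δ' : ℝ≥0∞} {Φ Ψ : α → β → Prop} {μ₁ : PMF α}
    {μ₂ : PMF β} (h : Lifting f δ Φ μ₁ μ₂) (hΦ : ∀ a b, Φ a b → Ψ a b)
    (hi : ∀ a b, Φ a b → IndexLe f δ g δ') : Lifting g δ' Ψ μ₁ μ₂ := by
  obtain ⟨μL, μR, hL, hR, h₁, h₂, hδ⟩ := h
  -- The support of a witness is nonempty, so the relation that indexes the bounds is inhabited.
  obtain ⟨p, hp⟩ := μL.support_nonempty
  obtain ⟨hfg, hδδ, -⟩ := hi _ _ (hL p hp)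
  exact ⟨μL, μR, fun p hp => hΦ _ _ (hL p hp), fun p hp => hΦ _ _ (hR p hp), h₁, h₂,
    (fDiv_mono hfg _ _).trans (hδ.trans (EReal.coe_ennreal_le_coe_ennreal_iff.2 hδδ))⟩

theorem Lifting.pure {f : ℝ≥0 → ℝ} (hf : FClass f) (δ : ℝ≥0∞) {Ψ : α → β → Prop} {a : α} {b : β}
    (h : Ψ a b) : Lifting f δ Ψ (PMF.pure a) (PMF.pure b) := by
  refine ⟨PMF.pure (a, b), PMF.pure (a, b), ?_, ?_, PMF.pure_map _ _, PMF.pure_map _ _, ?_⟩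
  · simpa using h
  · simpa using h
  · rw [AreClose, fDiv_self hf]
    exact EReal.coe_ennreal_nonneg δ

theorem bind_congr_support {γ : Type} (μ : PMF α) {M M' : α → PMF γ}
    (h : ∀ a ∈ μ.support, M a = M' a) : μ.bind M = μ.bind M' := by
  ext c
  rw [PMF.bind_apply, PMF.bind_apply]
  refine tsum_congr fun a => ?_
  by_cases ha : μ a = 0
  · simp [ha]
  · rw [h a ((PMF.mem_support_iff _ _).2 ha)]

/-- Sequential composition of liftings. -/
theorem Lifting.bind {γ γ' : Type} {f₁ f₂ f₃ : ℝ≥0 → ℝ} (hf : Composable f₁ f₂ f₃) {δ₁ δ₂ : ℝ≥0∞}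
    {Φ : α → β → Prop} {Ψ : γ → γ' → Prop} {μ₁ : PMF α} {μ₂ : PMF β} {M₁ : α → PMF γ}
    {M₂ : β → PMF γ'} (hμ : Lifting f₁ δ₁ Φ μ₁ μ₂)
    (hM : ∀ a b, Φ a b → Lifting f₂ δ₂ Ψ (M₁ a) (M₂ b)) :
    Lifting f₃ (δ₁ + δ₂) Ψ (μ₁.bind M₁) (μ₂.bind M₂) := by
  classical
  obtain ⟨μL, μR, hL, hR, rfl, rfl, hδ⟩ := hμ
  obtain ⟨p, hp⟩ := μL.support_nonempty
  obtain ⟨ν, -⟩ := hM _ _ (hL p hp)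
  -- Outside the relation both kernels take the same value `ν`, at divergence `0`, so that the
  -- supremum in the composability condition is bounded by `δ₂`.
  have hK : ∀ p : α × β, ∃ K : PMF (γ × γ') × PMF (γ × γ'), AreClose f₂ δ₂ K.1 K.2 ∧
      (Φ p.1 p.2 → (∀ q ∈ K.1.support, Ψ q.1 q.2) ∧ (∀ q ∈ K.2.support, Ψ q.1 q.2) ∧
        K.1.map Prod.fst = M₁ p.1 ∧ K.2.map Prod.snd = M₂ p.2) := fun p => by
    by_cases hp : Φ p.1 p.2
    · obtain ⟨νL, νR, h₁, h₂, h₃, h₄, h₅⟩ := hM _ _ hp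
      exact ⟨(νL, νR), h₅, fun _ => ⟨h₁, h₂, h₃, h₄⟩⟩
    · refine ⟨(ν, ν), ?_, fun h => absurd h hp⟩
      rw [AreClose, fDiv_self hf.2.1]
      exact EReal.coe_ennreal_nonneg δ₂
  choose K hKδ hKΦ using hK
  refine ⟨μL.bind fun p => (K p).1, μR.bind fun p => (K p).2, ?_, ?_, ?_, ?_, ?_⟩
  · intro q hq
    obtain ⟨p, hp, hq⟩ := (PMF.mem_support_bind_iff _ _ _).1 hq
    exact (hKΦ p (hL p hp)).1 q hq
  · intro q hq
    obtain ⟨p, hp, hq⟩ := (PMF.mem_support_bind_iff _ _ _).1 hq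
    exact (hKΦ p (hR p hp)).2.1 q hq
  · rw [PMF.map_bind, PMF.bind_map]
    exact bind_congr_support _ fun p hp => (hKΦ p (hL p hp)).2.2.1
  · rw [PMF.map_bind, PMF.bind_map]
    exact bind_congr_support _ fun p hp => (hKΦ p (hR p hp)).2.2.2
  · refine (hf.2.2.2 _ _ μL μR _ _).trans ?_
    rw [EReal.coe_ennreal_add]
    exact add_le_add hδ (iSup_le hKδ)

/-- A distribution on pairs that is carried by the diagonal is the image of its first marginal
and of its second marginal under the diagonal embedding. -/
theorem map_diag_of_support {μ : PMF (α × α)} (h : ∀ p ∈ μ.support, p.1 = p.2) :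
    (μ.map Prod.fst).map (fun a => (a, a)) = μ ∧ (μ.map Prod.snd).map (fun a => (a, a)) = μ := by
  constructor <;> rw [PMF.map_comp] <;>
    refine (bind_congr_support μ fun p hp => ?_).trans μ.bind_pure
  · exact congrArg PMF.pure (Prod.ext rfl (h p hp))
  · exact congrArg PMF.pure (Prod.ext (h p hp).symm rfl)

/-- The liftings of equality are exactly the bounds on divergences. -/
theorem lifting_eq_iff {f : ℝ≥0 → ℝ} {δ : ℝ≥0∞} {μ₁ μ₂ : PMF α} :
    Lifting f δ (fun a b => a = b) μ₁ μ₂ ↔ AreClose f δ μ₁ μ₂ := by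
  have hdiag : (fun a : α => (a, a)).Injective := fun a b h => congrArg Prod.fst h
  constructor
  · rintro ⟨μL, μR, hL, hR, rfl, rfl, h⟩
    rw [AreClose, ← fDiv_map_of_injective hdiag, (map_diag_of_support hL).1,
      (map_diag_of_support hR).2]
    exact h
  · intro h
    refine ⟨μ₁.map fun a => (a, a), μ₂.map fun a => (a, a), ?_, ?_, ?_, ?_, ?_⟩
    · simp
    · simp
    · exact (PMF.map_comp _ _ _).trans (PMF.map_id _)
    · exact (PMF.map_comp _ _ _).trans (PMF.map_id _)
    · exact (fDiv_map_of_injective hdiag f μ₁ μ₂).trans_le h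

end Divergence

theorem RTy.interp_eqv (S : Semantics) {Ξ : List Ty} (k : VTy) (θ : Env Ξ) :
    (RTy.eqv k).interp S θ = fun d₁ d₂ : k.interp => d₁ = d₂ := by
  funext d₁ d₂
  rw [RTy.eqv, RTy.interp, RTy.interp, true_and]
  rfl

theorem RTy.interp_mon_eqv (S : Semantics) {Ξ : List Ty} {k : VTy} {f : Tm Ξ .fn}
    {δ : Tm Ξ .ennreal} {θ : Env Ξ} {μ₁ μ₂ : PMF k.interp} :
    (RTy.mon f δ (.eqv k)).interp S θ μ₁ μ₂ ↔
      AreClose (f.denote S θ) (δ.denote S θ) μ₁ μ₂ := by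
  rw [RTy.interp, RTy.interp_eqv]
  exact lifting_eq_iff

/-! ### Soundness of subtyping -/

theorem RSub.sound (S : Semantics) {Γ : List Ty} {τ : Ty} {G : REnv Γ} {T U : RTy (dbl Γ) τ}
    (h : RSub S G T U) (θ : Env (dbl Γ)) (hθ : G.Valid S θ) (d₁ d₂ : τ.interp)
    (hd : T.interp S θ d₁ d₂) : U.interp S θ d₁ d₂ := by
  induction h with
  | refl T => exact hd
  | trans _ _ ih₁ ih₂ => exact ih₂ θ hθ _ _ (ih₁ θ hθ _ _ hd)
  | left T φ =>
    rw [RTy.interp] at hd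
    exact hd.1
  | right _ hφ ih =>
    rw [RTy.interp]
    exact ⟨ih θ hθ _ _ hd, hφ _ (REnv.valid_cons S hθ hd)⟩
  | pi _ _ ihT ihU =>
    rw [RTy.interp] at hd ⊢
    intro a₁ a₂ ha
    exact ihU _ (REnv.valid_cons S hθ ha) _ _ (hd _ _ (ihT θ hθ _ _ ha))
  | mon _ _ _ hi ih =>
    rw [RTy.interp] at hd ⊢
    exact Lifting.mono hd (fun a b => ih θ hθ a b)
      fun a b hab => hi _ (REnv.valid_cons S hθ hab)

/-! ### Recursion -/

theorem IsGuarded.recFun_eq {α β : Type} [Nonempty β] {Φ : (α → β) → α → β} (h : IsGuarded Φ) :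
    Φ (recFun Φ) = recFun Φ := by
  rw [recFun, dif_pos h]
  exact h.existsUnique.choose_spec.1

/-- Two guarded recursive functions are related if their bodies are related whenever the recursive
occurrences are related on arguments of smaller measure; by induction on the measure. -/
theorem recFun_related {α β α' β' : Type} [Nonempty β] [Nonempty β'] {Φ : (α → β) → α → β}
    {Φ' : (α' → β') → α' → β'} (hΦ : IsGuarded Φ) (hΦ' : IsGuarded Φ') {P : α → α' → Prop}
    {Q : α → α' → β → β' → Prop} (m : α → α' → ℕ)
    (h : ∀ g g' a a', P a a' → (∀ b b', P b b' → m b b' < m a a' → Q b b' (g b) (g' b')) →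
      Q a a' (Φ g a) (Φ' g' a')) (a : α) (a' : α') (ha : P a a') :
    Q a a' (recFun Φ a) (recFun Φ' a') := by
  induction hn : m a a' using Nat.strong_induction_on generalizing a a' with
  | _ n ih =>
    subst hn
    rw [← hΦ.recFun_eq, ← hΦ'.recFun_eq]
    exact h _ _ a a' ha fun b b' hb hlt => ih _ hlt b b' hb rfl

/-- The type of the recursive occurrence in `letrec` relates two functions if they are related on
all arguments whose measure is below that of the current arguments. -/
theorem RTy.interp_recTy (S : Semantics) {Ξ : List Ty} {τ σ : Ty} (T : RTy Ξ τ)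
    (U : RTy (τ :: τ :: Ξ) σ) (m : Tm (τ :: τ :: Ξ) .nat) (θ : Env Ξ) (a₁ a₂ : τ.interp)
    (g₁ g₂ : τ.interp → σ.interp) :
    (T.recTy U m).interp S ((θ.cons a₂).cons a₁) g₁ g₂ ↔
      ∀ b₁ b₂, T.interp S θ b₁ b₂ →
        @LT.lt ℕ _ (m.denote S ((θ.cons b₂).cons b₁)) (m.denote S ((θ.cons a₂).cons a₁)) →
        U.interp S ((θ.cons b₂).cons b₁) (g₁ b₁) (g₂ b₂) := by
  have hρ : ∀ b₁ b₂ : τ.interp,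
      (fun _ x => ((((θ.cons a₂).cons a₁).cons b₂).cons b₁) (Ren.under x) :
        Env (τ :: τ :: Ξ)) = (θ.cons b₂).cons b₁ := fun b₁ b₂ => by
    funext σ x
    rcases x with _ | _ | _ <;> rfl
  simp only [RTy.recTy, RTy.interp, RTy.interp_wk2, RTy.interp_rename, hρ, Assertion.interp,
    Tm.denote_wk2, Tm.denote_rename, Tm.succE, Tm.denote, and_imp]
  rfl

/-! ### Soundness of typing -/

theorem REnv.valid_cons_val (S : Semantics) {Γ : List Ty} {G : REnv Γ} {k : VTy}
    {θ : Env (dbl Γ)} (hθ : G.Valid S θ) (d₁ d₂ : k.interp) :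
    (G.cons (.val k)).Valid S (Env.cons (σ := .val k) d₁ (Env.cons (σ := .val k) d₂ θ)) :=
  REnv.valid_cons S hθ (by rw [RTy.interp]; trivial)

theorem Tm.denote_caseBool_true (S : Semantics) {Γ : List Ty} {σ : Ty} {e : Tm Γ .bool}
    (e₁ e₂ : Tm Γ σ) {θ : Env Γ} (h : @Eq Bool (e.denote S θ) true) :
    (Tm.caseBool e e₁ e₂).denote S θ = e₁.denote S θ := by
  rw [Tm.denote, h]
  rfl

theorem Tm.denote_caseBool_false (S : Semantics) {Γ : List Ty} {σ : Ty} {e : Tm Γ .bool}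
    (e₁ e₂ : Tm Γ σ) {θ : Env Γ} (h : @Eq Bool (e.denote S θ) false) :
    (Tm.caseBool e e₁ e₂).denote S θ = e₂.denote S θ := by
  rw [Tm.denote, h]
  rfl

theorem Tm.denote_caseNat_zero (S : Semantics) {Γ : List Ty} {σ : Ty} {e : Tm Γ .nat}
    (e₁ : Tm Γ σ) (e₂ : Tm (.nat :: Γ) σ) {θ : Env Γ} (h : @Eq ℕ (e.denote S θ) 0) :
    (Tm.caseNat e e₁ e₂).denote S θ = e₁.denote S θ := by
  rw [Tm.denote, h]
  rfl

theorem Tm.denote_caseNat_succ (S : Semantics) {Γ : List Ty} {σ : Ty} {e : Tm Γ .nat}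
    (e₁ : Tm Γ σ) (e₂ : Tm (.nat :: Γ) σ) {θ : Env Γ} {n : ℕ}
    (h : @Eq ℕ (e.denote S θ) (n + 1)) :
    (Tm.caseNat e e₁ e₂).denote S θ = e₂.denote S (θ.cons (σ := .nat) n) := by
  rw [Tm.denote, h]
  rfl

theorem Tm.denote_caseList_nil (S : Semantics) {Γ : List Ty} {b : BTy} {σ : Ty}
    {e : Tm Γ (.list b)} (e₁ : Tm Γ σ) (e₂ : Tm (.list b :: .val (.base b) :: Γ) σ) {θ : Env Γ}
    (h : @Eq (List b.interp) (e.denote S θ) []) :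
    (Tm.caseList e e₁ e₂).denote S θ = e₁.denote S θ := by
  rw [Tm.denote, h]
  rfl

theorem Tm.denote_caseList_cons (S : Semantics) {Γ : List Ty} {b : BTy} {σ : Ty}
    {e : Tm Γ (.list b)} (e₁ : Tm Γ σ) (e₂ : Tm (.list b :: .val (.base b) :: Γ) σ) {θ : Env Γ}
    {a : b.interp} {l : List b.interp} (h : @Eq (List b.interp) (e.denote S θ) (a :: l)) :
    (Tm.caseList e e₁ e₂).denote S θ =
      e₂.denote S (Env.cons (σ := .list b) l (Env.cons (σ := .val (.base b)) a θ)) := by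
  rw [Tm.denote, h]
  rfl

theorem RTyping.sound (S : Semantics) {Γ : List Ty} {τ : Ty} {G : REnv Γ} {e₁ e₂ : Tm Γ τ}
    {T : RTy (dbl Γ) τ} (h : RTyping S G e₁ e₂ T) (θ : Env (dbl Γ)) (hθ : G.Valid S θ) :
    T.interp S θ (e₁.denote S (Env.left θ)) (e₂.denote S (Env.right θ)) := by
  induction h with
  | var x => exact REnv.interp_get S _ x θ hθ
  | const c T h =>
    rw [RTy.interp_ofClosed]
    exact h
  | abs _ ih =>
    rw [RTy.interp]
    intro d₁ d₂ hd
    have h := ih _ (REnv.valid_cons S hθ hd)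
    rw [Env.left_cons, Env.right_cons] at h
    exact h
  | app _ _ ihe iha =>
    rw [RTy.interp_inst, Tm.denote_left, Tm.denote_right]
    have he := ihe θ hθ
    rw [RTy.interp] at he
    exact he _ _ (iha θ hθ)
  | @letrec Γ τ σ G e₁ e₂ T U m hguard _ ih =>
    rw [RTy.interp]
    refine recFun_related (hguard θ hθ).1 (hguard θ hθ).2
      (Q := fun a b => U.interp S ((θ.cons b).cons a))
      (fun a b => m.denote S ((θ.cons b).cons a)) ?_
    intro g g' a a' ha hg
    have h := ih _ (REnv.valid_cons S (REnv.valid_cons S hθ ha)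
      ((RTy.interp_recTy S T U m θ a a' g g').2 hg))
    rw [RTy.interp_wk2, Env.left_cons (Γ := τ :: Γ), Env.right_cons (Γ := τ :: Γ), Env.left_cons,
      Env.right_cons] at h
    exact h
  | sub _ hs ih => exact hs.sound S θ hθ _ _ (ih θ hθ)
  | self _ ih =>
    rw [RTy.interp]
    refine ⟨ih θ hθ, ?_⟩
    simp only [Assertion.interp, Tm.denote_wk2, Tm.denote_left, Tm.denote_right]
    exact ⟨rfl, rfl⟩
  | conv h₁ h₂ _ ih =>
    rw [h₁ θ hθ, h₂ θ hθ]
    exact ih θ hθ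
  | caseUnit _ _ _ ih => exact ih θ hθ
  | @caseBool Γ σ G e e' e₁ e₂ e₁' e₂' V T _ hsync _ _ _ ih₁ ih₂ =>
    rcases Bool.eq_false_or_eq_true (e.denote S (Env.left θ) : Bool) with h | h
    · have h' := (hsync θ hθ).1 h
      rw [Tm.denote_caseBool_true S _ _ h, Tm.denote_caseBool_true S _ _ h']
      refine ih₁ θ ⟨hθ, ?_⟩
      simp only [Assertion.interp, Tm.denote_left, Tm.denote_right]
      exact ⟨h, h'⟩
    · have h' := Bool.eq_false_of_not_eq_true (mt (hsync θ hθ).2 (ne_true_of_eq_false h))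
      rw [Tm.denote_caseBool_false S _ _ h, Tm.denote_caseBool_false S _ _ h']
      refine ih₂ θ ⟨hθ, ?_⟩
      simp only [Assertion.interp, Tm.denote_left, Tm.denote_right]
      exact ⟨h, h'⟩
  | @caseNat Γ σ G e e' e₁ e₁' e₂ e₂' V T _ hsync _ _ _ ih₁ ih₂ =>
    rcases eq_or_ne (e.denote S (Env.left θ) : ℕ) 0 with h | h
    · have h' := (hsync θ hθ).1 h
      rw [Tm.denote_caseNat_zero S _ _ h, Tm.denote_caseNat_zero S _ _ h']
      refine ih₁ θ ⟨hθ, ?_⟩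
      simp only [Assertion.interp, Tm.denote_left, Tm.denote_right]
      exact ⟨h, h'⟩
    · obtain ⟨n, hn⟩ := Nat.exists_eq_succ_of_ne_zero h
      obtain ⟨n', h'⟩ := Nat.exists_eq_succ_of_ne_zero (mt (hsync θ hθ).2 h)
      rw [Tm.denote_caseNat_succ S _ _ hn, Tm.denote_caseNat_succ S _ _ h']
      have ih := ih₂ _ ⟨REnv.valid_cons_val S hθ n n', by
        simp only [Assertion.interp, Tm.denote_wk2, Tm.denote_left, Tm.denote_right]
        exact ⟨hn, h'⟩⟩
      rw [RTy.interp_wk2, Env.left_cons, Env.right_cons] at ih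
      exact ih
  | @caseList Γ b σ G e e' e₁ e₁' e₂ e₂' V T _ hsync _ _ _ ih₁ ih₂ =>
    rcases eq_or_ne (e.denote S (Env.left θ) : List b.interp) [] with h | h
    · have h' := (hsync θ hθ).1 h
      rw [Tm.denote_caseList_nil S _ _ h, Tm.denote_caseList_nil S _ _ h']
      refine ih₁ θ ⟨hθ, ?_⟩
      simp only [Assertion.interp, Tm.denote_left, Tm.denote_right]
      exact ⟨h, h'⟩
    · obtain ⟨a, l, hl⟩ := List.exists_cons_of_ne_nil h
      obtain ⟨a', l', h'⟩ := List.exists_cons_of_ne_nil (mt (hsync θ hθ).2 h)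
      rw [Tm.denote_caseList_cons S _ _ hl, Tm.denote_caseList_cons S _ _ h']
      have ih := ih₂ _ ⟨REnv.valid_cons_val S (REnv.valid_cons_val S hθ a a') l l', by
        simp only [Assertion.interp, Tm.denote_wk2, Tm.denote_left, Tm.denote_right]
        exact ⟨hl, h'⟩⟩
      rw [RTy.interp_wk2, RTy.interp_wk2, Env.left_cons (Γ := .val (.base b) :: Γ),
        Env.right_cons (Γ := .val (.base b) :: Γ), Env.left_cons, Env.right_cons] at ih
      exact ih
  | @caseBoolL Γ σ G e e₁ e₂ e' T _ _ ih₁ ih₂ =>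
    rcases Bool.eq_false_or_eq_true (e.denote S (Env.left θ) : Bool) with h | h
    · rw [Tm.denote_caseBool_true S _ _ h]
      refine ih₁ θ ⟨hθ, ?_⟩
      rw [Assertion.interp, Tm.denote_left]
      exact h
    · rw [Tm.denote_caseBool_false S _ _ h]
      refine ih₂ θ ⟨hθ, ?_⟩
      rw [Assertion.interp, Tm.denote_left]
      exact h
  -- In the one-sided rules for numbers and lists the idle run does not mention the pattern
  -- variables, whose instances for that run may be any values; those of the other run are used.
  | @caseNatL Γ σ G e e₁ e' e₂ T _ _ ih₁ ih₂ =>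
    rcases eq_or_ne (e.denote S (Env.left θ) : ℕ) 0 with h | h
    · rw [Tm.denote_caseNat_zero S _ _ h]
      refine ih₁ θ ⟨hθ, ?_⟩
      rw [Assertion.interp, Tm.denote_left]
      exact h
    · obtain ⟨n, hn⟩ := Nat.exists_eq_succ_of_ne_zero h
      rw [Tm.denote_caseNat_succ S _ _ hn]
      have ih := ih₂ _ ⟨REnv.valid_cons_val S hθ n n, by
        rw [Assertion.interp, Tm.denote_wk2, Tm.denote_left]
        exact hn⟩
      rw [RTy.interp_wk2, Env.left_cons, Env.right_cons, Tm.denote_wk] at ih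
      exact ih
  | @caseListL Γ b σ G e e₁ e' e₂ T _ _ ih₁ ih₂ =>
    rcases eq_or_ne (e.denote S (Env.left θ) : List b.interp) [] with h | h
    · rw [Tm.denote_caseList_nil S _ _ h]
      refine ih₁ θ ⟨hθ, ?_⟩
      rw [Assertion.interp, Tm.denote_left]
      exact h
    · obtain ⟨a, l, hl⟩ := List.exists_cons_of_ne_nil h
      rw [Tm.denote_caseList_cons S _ _ hl]
      have ih := ih₂ _ ⟨REnv.valid_cons_val S (REnv.valid_cons_val S hθ a a) l l, by
        rw [Assertion.interp, Tm.denote_wk2, Tm.denote_wk2, Tm.denote_left]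
        exact hl⟩
      rw [RTy.interp_wk2, RTy.interp_wk2, Env.left_cons (Γ := .val (.base b) :: Γ),
        Env.right_cons (Γ := .val (.base b) :: Γ), Env.left_cons, Env.right_cons, Tm.denote_wk,
        Tm.denote_wk] at ih
      exact ih
  | @caseBoolR Γ σ G e e₁ e₂ e' T _ _ ih₁ ih₂ =>
    rcases Bool.eq_false_or_eq_true (e.denote S (Env.right θ) : Bool) with h | h
    · rw [Tm.denote_caseBool_true S _ _ h]
      refine ih₁ θ ⟨hθ, ?_⟩
      rw [Assertion.interp, Tm.denote_right]
      exact h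
    · rw [Tm.denote_caseBool_false S _ _ h]
      refine ih₂ θ ⟨hθ, ?_⟩
      rw [Assertion.interp, Tm.denote_right]
      exact h
  | @caseNatR Γ σ G e e₁ e' e₂ T _ _ ih₁ ih₂ =>
    rcases eq_or_ne (e.denote S (Env.right θ) : ℕ) 0 with h | h
    · rw [Tm.denote_caseNat_zero S _ _ h]
      refine ih₁ θ ⟨hθ, ?_⟩
      rw [Assertion.interp, Tm.denote_right]
      exact h
    · obtain ⟨n, hn⟩ := Nat.exists_eq_succ_of_ne_zero h
      rw [Tm.denote_caseNat_succ S _ _ hn]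
      have ih := ih₂ _ ⟨REnv.valid_cons_val S hθ n n, by
        rw [Assertion.interp, Tm.denote_wk2, Tm.denote_right]
        exact hn⟩
      rw [RTy.interp_wk2, Env.left_cons, Env.right_cons, Tm.denote_wk] at ih
      exact ih
  | @caseListR Γ b σ G e e₁ e' e₂ T _ _ ih₁ ih₂ =>
    rcases eq_or_ne (e.denote S (Env.right θ) : List b.interp) [] with h | h
    · rw [Tm.denote_caseList_nil S _ _ h]
      refine ih₁ θ ⟨hθ, ?_⟩
      rw [Assertion.interp, Tm.denote_right]
      exact h
    · obtain ⟨a, l, hl⟩ := List.exists_cons_of_ne_nil h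
      rw [Tm.denote_caseList_cons S _ _ hl]
      have ih := ih₂ _ ⟨REnv.valid_cons_val S (REnv.valid_cons_val S hθ a a) l l, by
        rw [Assertion.interp, Tm.denote_wk2, Tm.denote_wk2, Tm.denote_right]
        exact hl⟩
      rw [RTy.interp_wk2, RTy.interp_wk2, Env.left_cons (Γ := .val (.base b) :: Γ),
        Env.right_cons (Γ := .val (.base b) :: Γ), Env.left_cons, Env.right_cons, Tm.denote_wk,
        Tm.denote_wk] at ih
      exact ih
  | unitM hf _ ih =>
    rw [RTy.interp]
    exact Lifting.pure (hf θ hθ) _ (ih θ hθ)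
  | @bindM Γ k l G e₁ e₁' e₂ e₂' T₁ T₂ f₁ f₂ f₃ δ₁ δ₂ _ hcomp _ ih₁ ih₂ =>
    have h₁ := ih₁ θ hθ
    rw [RTy.interp] at h₁ ⊢
    refine Lifting.bind (hcomp θ hθ) h₁ fun a b hab => ?_
    have h₂ := ih₂ _ (REnv.valid_cons S hθ hab)
    rw [RTy.interp_wk2, RTy.interp, Env.left_cons, Env.right_cons] at h₂
    exact h₂
  | infer _ ih =>
    have h := RTy.interp_mon_eqv S |>.1 (ih θ hθ)
    rw [RTy.interp, RTy.interp, Assertion.interp, Tm.denote_wk2, Tm.denote_wk2]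
    refine ⟨trivial, ?_⟩
    simp only [Tm.denote, Env.cons, S.algInf_exact]
    exact h
  | ran _ ih =>
    have h := ih θ hθ
    rw [RTy.interp, Assertion.interp, Tm.denote_wk2, Tm.denote_wk2] at h
    exact (RTy.interp_mon_eqv S).2 h.2
  | observe _ _ hdiv _ _ | lapMech _ _ hdiv _ _ | gaussMech _ _ hdiv _ _
  | expMech _ _ _ hdiv _ _ _ =>
    have h := hdiv θ hθ
    rw [Assertion.interp, Tm.denote_left, Tm.denote_right] at h
    exact (RTy.interp_mon_eqv S).2 h
  | bernoulli | uniform | beta | normal =>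
    rw [RTy.interp]
    trivial

end PrivInfer

theorem mainTheorem1 (S : PrivInfer.Semantics) {Γ : List PrivInfer.Ty} {τ : PrivInfer.Ty}
    (G : PrivInfer.REnv Γ) (e₁ e₂ : PrivInfer.Tm Γ τ) (T : PrivInfer.RTy (PrivInfer.dbl Γ) τ)
    (h : PrivInfer.RTyping S G e₁ e₂ T) (θ : PrivInfer.Env (PrivInfer.dbl Γ))
    (hθ : G.Valid S θ) :
    T.interp S θ (e₁.denote S (PrivInfer.Env.left θ)) (e₂.denote S (PrivInfer.Env.right θ)) :=
  h.sound S θ hθ
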